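/- Let $r=c_6=\dfrac{\sin(\pi/12)}{1-\sin(\pi/12)}$. A \emph{packing} with discs of radii $1$ and $r$ is a set of discs in the Euclidean plane with pairwise disjoint interiors, each of radius $1$ (large) or $r$ (small), in which both radii occur. A \emph{neighbour sequence} of a disc $D$ of the packing is a cyclic sequence $D_1,\dots,D_n$ ($D_{n+1}=D_1$) of discs of the packing, each tangent to $D$, with $D_i$ tangent to $D_{i+1}$ for $i=1,\dots,n$, which goes around $D$ exactly once, counterclockwise (each oriented angle at the centre of $D$ from the centre of $D_i$ to that of $D_{i+1}$ is positive, and these angles sum to $2\pi$). The packing is \emph{compact} if each of its discs has a neighbour sequence. Let $\mathcal H$ be the following set of discs in $\mathbb C$: discs of radius $1$ centred at the points of the triangular lattice $\Lambda=\ell\,(\mathbb Z+\mathbb Z e^{i\pi/3})$, where $\ell=2(1+r)\cos(\pi/12)$, and discs of radius $r$ centred at the points $\lambda+(1+r)e^{i(\pi/12+k\pi/6)}$ with $\lambda\in\Lambda$ and $k=0,\dots,11$. Then: 1. $\mathcal H$ is a compact packing with discs of radii $1$ and $r$. 2. In every compact packing with discs of radii $1$ and $r$, every neighbour sequence of a disc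 $D$ consists of distinct discs and contains all the discs of the packing that are tangent to $D$. If $D$ is small, the radii along the sequence are, up to cyclic permutation, $1,r,r,1,r$; if $D$ is large, they are $r,r,\dots,r$ ($12$ terms). In particular every large disc is surrounded by exactly twelve small discs and touches no large disc. 3. Every compact packing with discs of radii $1$ and $r$ is the image of $\mathcal H$ under an isometry of the plane. So the compact packing is unique up to isometry. -/

import Mathlib

/-- A disc of the Euclidean plane `ℂ`, given by its centre and its radius. -/
structure Disc where
  center : ℂ
  radius : ℝ

namespace Disc

/-- The interior of a disc. -/
def inner (d : Disc) : Set ℂ := Metric.ball d.center d.radius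

/-- External tangency of two discs. -/
def Tangent (d e : Disc) : Prop := dist d.center e.center = d.radius + e.radius

/-- The image of a disc under an isometry of the plane. -/
noncomputable def map (g : ℂ ≃ᵢ ℂ) (d : Disc) : Disc := ⟨g d.center, d.radius⟩

/-- The oriented angle in `(-π, π]`, at the centre of `d`, from the centre of `e` to the
centre of `e'`. -/
noncomputable def angle (d e e' : Disc) : ℝ :=
  Complex.arg ((e'.center - d.center) / (e.center - d.center))

end Disc

/-- A packing of discs of the two radii `1` and `r`: the discs have pairwise disjoint interiors,
every radius is `1` or `r`, and both radii occur. -/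
structure IsPacking (r : ℝ) (P : Set Disc) : Prop where
  radius_eq : ∀ d ∈ P, d.radius = 1 ∨ d.radius = r
  disjoint : P.PairwiseDisjoint Disc.inner
  exists_large : ∃ d ∈ P, d.radius = 1
  exists_small : ∃ d ∈ P, d.radius = r

/-- `D 0, …, D (n - 1)` is a neighbour sequence of the disc `d` in `P`: a closed chain of discs
of `P`, all tangent to `d`, each one tangent to its (cyclic) successor, which goes around `d`
exactly once, counterclockwise. (`finRotate n` is the cyclic successor on `Fin n`.) -/
structure IsNeighbourSequence (P : Set Disc) (d : Disc) {n : ℕ} (D : Fin n → Disc) : Prop where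
  mem : ∀ i, D i ∈ P
  tangent : ∀ i, d.Tangent (D i)
  tangent_succ : ∀ i, (D i).Tangent (D (finRotate n i))
  angle_pos : ∀ i, 0 < d.angle (D i) (D (finRotate n i))
  angle_sum : ∑ i, d.angle (D i) (D (finRotate n i)) = 2 * Real.pi

/-- A compact packing by discs of radii `1` and `r`: every disc is surrounded by a closed chain
of successively tangent discs, all tangent to it. -/
structure IsCompactPacking (r : ℝ) (P : Set Disc) : Prop extends IsPacking r P where
  surrounded : ∀ d ∈ P, ∃ (n : ℕ) (D : Fin n → Disc), IsNeighbourSequence P d D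

/-- The radius `c₆ = sin (π / 12) / (1 - sin (π / 12))`. -/
noncomputable def c6 : ℝ := Real.sin (Real.pi / 12) / (1 - Real.sin (Real.pi / 12))

/-- The points of the triangular lattice, with minimal distance `2 (1 + c₆) cos (π / 12)`, that
is generated by this real number and its rotation by `π / 3`. -/
noncomputable def latticePoint (a b : ℤ) : ℂ :=
  ((2 * (1 + c6) * Real.cos (Real.pi / 12) : ℝ) : ℂ) *
    ((a : ℂ) + (b : ℂ) * Complex.exp (((Real.pi / 3 : ℝ) : ℂ) * Complex.I))

/-- The explicit configuration: a disc of radius `1` at every lattice point, and around each of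
them twelve discs of radius `c₆` tangent to it, in the directions `π / 12 + k π / 6`. (Each small
disc touches two large ones and so is described twice.) -/
noncomputable def hexagonalPacking : Set Disc :=
  {d | ∃ a b : ℤ, d = ⟨latticePoint a b, 1⟩} ∪
  {d | ∃ (a b : ℤ) (k : Fin 12), d = ⟨latticePoint a b + ((1 + c6 : ℝ) : ℂ) *
    Complex.exp (((Real.pi / 12 + (k : ℕ) * (Real.pi / 6) : ℝ) : ℂ) * Complex.I), c6⟩}

/-!
A compact packing is determined by the angles between tangent discs. Three pairwise tangent discs
subtend at the centre of one of them an angle that depends on the radii only (`tangentAngle`). For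
the radii `1` and `c₆` these angles are `60°`, `75°` and `180° - 2 A` at a small disc, and `60°`,
`30°` and `A` at a large one, with `A = arccos (1 - sin 15°)` between `41.25°` and `45°`
(`lt_mixedAngle`, `mixedAngle_lt`). Since the angles of a neighbour sequence add up to `360°`, the
only candidates are six small discs or `1, c₆, c₆, 1, c₆` around a small disc, and six large or
twelve small discs around a large one (`pairCount_of_small`, `pairCount_of_large`). The sectors
between successive neighbours are then so narrow that no further disc of the packing fits in between
(`IsNeighbourSequence.mem_range`): a neighbour sequence lists all tangent discs.

The candidates with six equal discs and the uniqueness of the packing both depend on connectedness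
(`IsCompactPacking.eq_of_tangent_mem`): a nonempty part of a compact packing that is closed under
tangency is the whole packing. For a disc `e` outside the part, take a disc `d` of the part whose
centre is nearest to that of `e`. The neighbours of `d` that bound the sector of `e` are not nearer,
so that the distance is at most the circumradius of a triangle of centres of tangent discs, and
this is too small for `e`. Now a large disc that touches a large one would have only neighbours of
the same kind, and so would a small disc that touches no large one; in both cases one of the radii
could not occur.

Thus the small discs around a large one are `30°` apart, and every small disc touches two large
ones, seen under the angle `150°`. Starting from one edge of the lattice (`IsEdge`), this reproduces
all edges turned by `60°` or translated along themselves, hence a copy of the hexagonal packing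
(`IsCompactPacking.exists_image_subset`). The copy is closed under tangency as each of its discs is
surrounded within it, so that it is everything.

That the hexagonal packing is a packing is checked in coordinates with respect to the lattice
(`IsSmallCoord`); its neighbour sequences are written down in directions that are multiples of
`15°`.
-/

/-! ### The radius `c₆` and the angles between tangent discs -/

open Real in
theorem sin_pi_div_twelve_sq : sin (π / 12) ^ 2 = (2 - √3) / 4 := by
  have h := Real.cos_sq' (π / 12)
  have h2 := Real.cos_sq (π / 12)
  rw [show 2 * (π / 12) = π / 6 by ring, Real.cos_pi_div_six] at h2
  linarith

theorem sin_pi_div_twelve_pos : 0 < Real.sin (Real.pi / 12) :=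
  Real.sin_pos_of_pos_of_lt_pi (by positivity) (by linarith [Real.pi_pos])

theorem sqrt_three_bounds : 1.732 < √3 ∧ √3 < 1.73206 :=
  ⟨Real.lt_sqrt_of_sq_lt (by norm_num), (Real.sqrt_lt' (by norm_num)).2 (by norm_num)⟩

theorem sin_pi_div_twelve_bounds :
    0.2588 < Real.sin (Real.pi / 12) ∧ Real.sin (Real.pi / 12) < 0.2589 := by
  have h := sin_pi_div_twelve_sq
  have hp := sin_pi_div_twelve_pos
  have := sqrt_three_bounds
  constructor <;> nlinarith

theorem c6_pos : 0 < c6 := by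
  have := sin_pi_div_twelve_bounds
  exact div_pos (by linarith) (by linarith)

theorem c6_eq : c6 = (1 + c6) * Real.sin (Real.pi / 12) := by
  have := sin_pi_div_twelve_bounds
  have h : (1 - Real.sin (Real.pi / 12)) ≠ 0 := by linarith
  rw [c6]; field_simp; ring

theorem c6_bounds : 0.349 < c6 ∧ c6 < 0.3494 := by
  have := sin_pi_div_twelve_bounds
  have := c6_eq
  constructor <;> nlinarith

/-- The angle at the centre of a disc of radius `ρ` between two discs of radii `x` and `y`, when
the three discs are pairwise tangent. -/
noncomputable def tangentAngle (ρ x y : ℝ) : ℝ :=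
  Real.arccos ((ρ ^ 2 + ρ * x + ρ * y - x * y) / ((ρ + x) * (ρ + y)))

theorem tangentAngle_comm (ρ x y : ℝ) : tangentAngle ρ x y = tangentAngle ρ y x := by
  unfold tangentAngle
  congr 1
  ring

/-- The angle at the centre of a large disc between a tangent large disc and a tangent small
disc, itself tangent to the former. It is about `42.17°`. -/
noncomputable def mixedAngle : ℝ := Real.arccos (1 - Real.sin (Real.pi / 12))

theorem tangentAngle_eq_of_cos {ρ x y θ : ℝ} (hx : 0 < ρ + x) (hy : 0 < ρ + y) (h0 : 0 ≤ θ)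
    (hπ : θ ≤ Real.pi)
    (h : (ρ + x) * (ρ + y) * Real.cos θ = ρ ^ 2 + ρ * x + ρ * y - x * y) :
    tangentAngle ρ x y = θ := by
  rw [tangentAngle, ← h, mul_div_cancel_left₀ _ (by positivity), Real.arccos_cos h0 hπ]

theorem cos_mixedAngle : Real.cos mixedAngle = 1 - Real.sin (Real.pi / 12) := by
  have := sin_pi_div_twelve_bounds
  exact Real.cos_arccos (by linarith) (by linarith)

theorem mixedAngle_lt : mixedAngle < Real.pi / 4 := by
  by_contra! h
  have h1 := Real.cos_le_cos_of_nonneg_of_le_pi (by positivity) (Real.arccos_le_pi _) h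
  rw [← mixedAngle, cos_mixedAngle, Real.cos_pi_div_four] at h1
  have := sin_pi_div_twelve_bounds
  have h2 : √2 < 1.48 := (Real.sqrt_lt' (by norm_num)).2 (by norm_num)
  linarith

theorem lt_mixedAngle : 11 * Real.pi / 48 < mixedAngle := by
  by_contra! h
  have h0 : 0 ≤ mixedAngle := Real.arccos_nonneg _
  -- The doubled angle is compared: `2 (1 - s) ^ 2 - 1 < sin (π / 24)`.
  have h1 := Real.cos_le_cos_of_nonneg_of_le_pi (x := 2 * mixedAngle)
    (y := Real.pi / 2 - Real.pi / 24) (by positivity) (by linarith [Real.pi_pos]) (by linarith)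
  rw [Real.cos_two_mul, cos_mixedAngle, Real.cos_pi_div_two_sub] at h1
  have h2 := Real.sin_gt_sub_cube (x := Real.pi / 24) (by positivity)
  have h3 := Real.pi_gt_d2
  have h4 := Real.pi_lt_d2
  have := sin_pi_div_twelve_bounds
  have h5 : (Real.pi / 24) ^ 3 ≤ (0.132) ^ 3 := by gcongr; linarith
  norm_num at h5
  nlinarith

theorem tangentAngle_self {x : ℝ} (hx : 0 < x) : tangentAngle x x x = Real.pi / 3 := by
  apply tangentAngle_eq_of_cos <;> try linarith [Real.pi_pos]
  rw [Real.cos_pi_div_three]; ring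

theorem tangentAngle_small_large_small : tangentAngle c6 1 c6 = 5 * Real.pi / 12 := by
  have := c6_pos
  apply tangentAngle_eq_of_cos <;> try linarith [Real.pi_pos]
  rw [show 5 * Real.pi / 12 = Real.pi / 2 - Real.pi / 12 by ring, Real.cos_pi_div_two_sub]
  linear_combination -2 * c6 * c6_eq

theorem tangentAngle_large_small_small : tangentAngle 1 c6 c6 = Real.pi / 6 := by
  have := c6_pos
  apply tangentAngle_eq_of_cos <;> try linarith [Real.pi_pos]
  rw [show Real.pi / 6 = 2 * (Real.pi / 12) by ring, Real.cos_two_mul']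
  rw [Real.cos_sq']
  linear_combination (2 * c6 + 2 * (1 + c6) * Real.sin (Real.pi / 12)) * c6_eq

theorem tangentAngle_large_large_small : tangentAngle 1 1 c6 = mixedAngle := by
  have := c6_pos
  apply tangentAngle_eq_of_cos (by linarith) (by linarith) (Real.arccos_nonneg _)
    (Real.arccos_le_pi _)
  rw [← mixedAngle, cos_mixedAngle]
  linear_combination 2 * c6_eq

theorem tangentAngle_small_large_large : tangentAngle c6 1 1 = Real.pi - 2 * mixedAngle := by
  have := c6_pos
  have := lt_mixedAngle
  have := mixedAngle_lt
  apply tangentAngle_eq_of_cos <;> try linarith [Real.pi_pos]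
  rw [Real.cos_pi_sub, Real.cos_two_mul, cos_mixedAngle]
  linear_combination -2 * (1 + (1 + c6) * (1 - Real.sin (Real.pi / 12))) * c6_eq

/-! ### Directions seen from a point -/

/-- The vector `v` points in the direction obtained from that of `a` by a turn through the
angle `τ`. -/
def Turn (a v : ℂ) (τ : ℝ) : Prop :=
  v * ‖a‖ = a * ‖v‖ * Complex.exp (τ * Complex.I)

theorem turn_arg {a : ℂ} (ha : a ≠ 0) (v : ℂ) : Turn a v (v / a).arg := by
  have h := Complex.norm_mul_exp_arg_mul_I (v / a)
  have : (‖a‖ : ℂ) ≠ 0 := by simpa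
  rw [norm_div, Complex.ofReal_div] at h
  rw [Turn]
  field_simp at h
  linear_combination -h

theorem Turn.eq {a v : ℂ} {τ : ℝ} (h : Turn a v τ) (ha : a ≠ 0) :
    v = a * ((‖v‖ / ‖a‖ : ℝ) : ℂ) * Complex.exp (τ * Complex.I) := by
  have : (‖a‖ : ℂ) ≠ 0 := by simpa
  push_cast
  field_simp
  exact h

theorem Turn.norm_sub_sq {a v : ℂ} {τ : ℝ} (h : Turn a v τ) (ha : a ≠ 0) :
    ‖v - a‖ ^ 2 = ‖v‖ ^ 2 + ‖a‖ ^ 2 - 2 * ‖v‖ * ‖a‖ * Real.cos τ := by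
  have ha' : ‖a‖ ≠ 0 := by simpa
  have h1 : v - a = a * (((‖v‖ / ‖a‖ : ℝ) : ℂ) * Complex.exp (τ * Complex.I) - 1) := by
    conv_lhs => rw [h.eq ha]
    ring
  have h2 : ∀ t : ℝ, ‖(t : ℂ) * Complex.exp (τ * Complex.I) - 1‖ ^ 2
      = t ^ 2 + 1 - 2 * t * Real.cos τ := by
    intro t
    rw [← Complex.normSq_eq_norm_sq, Complex.normSq_apply]
    simp [Complex.exp_ofReal_mul_I_re, Complex.exp_ofReal_mul_I_im]
    linear_combination t ^ 2 * Real.sin_sq_add_cos_sq τ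
  rw [h1, norm_mul, mul_pow, h2]
  field_simp

theorem Turn.sub {a b v : ℂ} {θ τ : ℝ} (hb : Turn a b θ) (hv : Turn a v τ) (ha : a ≠ 0) :
    Turn b v (τ - θ) := by
  have ha' : (‖a‖ : ℂ) ≠ 0 := by simpa
  unfold Turn at *
  have he : Complex.exp (τ * Complex.I)
      = Complex.exp (θ * Complex.I) * Complex.exp ((τ - θ : ℝ) * Complex.I) := by
    rw [← Complex.exp_add]; push_cast; ring_nf
  apply mul_right_cancel₀ ha'
  rw [he] at hv
  linear_combination ‖b‖ * hv - ‖v‖ * Complex.exp ((τ - θ : ℝ) * Complex.I) * hb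

theorem Turn.neg {a b : ℂ} {θ : ℝ} (hb : Turn a b θ) : Turn b a (-θ) := by
  unfold Turn at *
  have he : Complex.exp (θ * Complex.I) * Complex.exp ((-θ : ℝ) * Complex.I) = 1 := by
    rw [← Complex.exp_add, ← Complex.exp_zero]; push_cast; ring_nf
  linear_combination - Complex.exp ((-θ : ℝ) * Complex.I) * hb - a * ‖b‖ * he

theorem Turn.add {a b v : ℂ} {θ τ : ℝ} (hb : Turn a b θ) (hv : Turn b v τ) (hb0 : b ≠ 0) :
    Turn a v (θ + τ) := by
  have := hb.neg.sub hv hb0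
  rwa [sub_neg_eq_add, add_comm] at this

/-- The angle of a turn is unique in an interval of length `2 π`. -/
theorem Turn.unique {a v : ℂ} {τ τ' : ℝ} (h : Turn a v τ) (h' : Turn a v τ') (ha : a ≠ 0)
    (hv : v ≠ 0) (hlt : |τ - τ'| < 2 * Real.pi) : τ = τ' := by
  have h1 : Complex.exp (τ * Complex.I) = Complex.exp (τ' * Complex.I) := by
    have : a * (‖v‖ : ℂ) ≠ 0 := by simp [ha, hv]
    exact mul_left_cancel₀ this (h.symm.trans h')
  obtain ⟨n, hn⟩ := Complex.exp_eq_exp_iff_exists_int.1 h1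
  have h2 : τ = τ' + n * (2 * Real.pi) := by
    have := congrArg Complex.im hn
    simpa using this
  have h3 : |(n : ℝ)| < 1 := by
    rw [h2, add_sub_cancel_left, abs_mul, abs_of_pos Real.two_pi_pos] at hlt
    nlinarith [Real.pi_pos]
  have h4 : n = 0 := by
    rw [← Int.abs_lt_one_iff]; exact_mod_cast h3
  simp [h2, h4]

theorem exists_turn {a : ℂ} (ha : a ≠ 0) (v : ℂ) :
    ∃ τ : ℝ, 0 ≤ τ ∧ τ < 2 * Real.pi ∧ Turn a v τ := by
  rcases le_or_gt 0 (v / a).arg with h | h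
  · exact ⟨_, h, by linarith [Complex.arg_le_pi (v / a), Real.pi_pos], turn_arg ha v⟩
  · refine ⟨(v / a).arg + 2 * Real.pi, by linarith [Complex.neg_pi_lt_arg (v / a), Real.pi_pos],
      by linarith, ?_⟩
    have := turn_arg ha v
    unfold Turn at *
    rw [this]
    push_cast
    rw [add_mul, Complex.exp_add, Complex.exp_two_pi_mul_I, mul_one]

/-! ### Tangent discs in a packing -/

theorem one_ne_c6 : (1 : ℝ) ≠ c6 := by
  have := c6_bounds
  linarith

theorem IsPacking.radius_pos {P : Set Disc} (hP : IsPacking c6 P) {d : Disc} (hd : d ∈ P) :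
    0 < d.radius := by
  have := c6_pos
  rcases hP.radius_eq d hd with h | h <;> rw [h] <;> linarith

theorem IsPacking.c6_le_radius {P : Set Disc} (hP : IsPacking c6 P) {d : Disc} (hd : d ∈ P) :
    c6 ≤ d.radius := by
  have := c6_bounds
  rcases hP.radius_eq d hd with h | h <;> rw [h]
  linarith

theorem IsPacking.radius_add_le_dist {P : Set Disc} (hP : IsPacking c6 P) {d e : Disc}
    (hd : d ∈ P) (he : e ∈ P) (hne : d ≠ e) : d.radius + e.radius ≤ dist d.center e.center :=
  (disjoint_ball_ball_iff (hP.radius_pos hd) (hP.radius_pos he)).1 (hP.disjoint hd he hne)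

theorem Disc.Tangent.symm {d e : Disc} (h : d.Tangent e) : e.Tangent d := by
  unfold Disc.Tangent at *
  rw [dist_comm, h, add_comm]

theorem Disc.Tangent.norm_sub {d e : Disc} (h : d.Tangent e) :
    ‖e.center - d.center‖ = d.radius + e.radius := by
  rw [← dist_eq_norm, dist_comm, h]

theorem Disc.Tangent.sub_ne_zero {d e : Disc} (h : d.Tangent e) (hr : 0 < d.radius + e.radius) :
    e.center - d.center ≠ 0 := by
  rw [← norm_pos_iff, h.norm_sub]; exact hr

theorem IsPacking.norm_sub_ne_zero {P : Set Disc} (hP : IsPacking c6 P) {d e : Disc}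
    (hd : d ∈ P) (he : e ∈ P) (h : d.Tangent e) : e.center - d.center ≠ 0 :=
  h.sub_ne_zero (add_pos (hP.radius_pos hd) (hP.radius_pos he))

/-- Two different discs of a packing that touch the disc `d` are seen from its centre under at
least the angle under which they would be seen if they were tangent. -/
theorem IsPacking.tangentAngle_le {P : Set Disc} (hP : IsPacking c6 P) {d e f : Disc}
    (hd : d ∈ P) (he : e ∈ P) (hf : f ∈ P) (hef : e ≠ f) (hde : d.Tangent e) (hdf : d.Tangent f)
    {τ : ℝ} (h0 : 0 ≤ τ) (hπ : τ ≤ Real.pi)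
    (h : Turn (e.center - d.center) (f.center - d.center) τ) :
    tangentAngle d.radius e.radius f.radius ≤ τ := by
  have h1 := h.norm_sub_sq (hP.norm_sub_ne_zero hd he hde)
  have h2 := hP.radius_add_le_dist he hf hef
  rw [hde.norm_sub, hdf.norm_sub, sub_sub_sub_cancel_right, ← dist_eq_norm, dist_comm] at h1
  have hx := hP.radius_pos he
  have hy := hP.radius_pos hf
  have hρ := hP.radius_pos hd
  have h3 := pow_le_pow_left₀ (by positivity) h2 2
  rw [h1] at h3
  rw [tangentAngle, ← Real.arccos_cos h0 hπ]
  apply Real.arccos_le_arccos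
  rw [le_div_iff₀ (by positivity)]
  linarith

theorem IsPacking.eq_tangentAngle {P : Set Disc} (hP : IsPacking c6 P) {d e f : Disc}
    (hd : d ∈ P) (he : e ∈ P) (hf : f ∈ P) (hef : e.Tangent f) (hde : d.Tangent e)
    (hdf : d.Tangent f) {τ : ℝ} (h0 : 0 ≤ τ) (hπ : τ ≤ Real.pi)
    (h : Turn (e.center - d.center) (f.center - d.center) τ) :
    τ = tangentAngle d.radius e.radius f.radius := by
  have h1 := h.norm_sub_sq (hP.norm_sub_ne_zero hd he hde)
  have hx := hP.radius_pos he
  have hy := hP.radius_pos hf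
  have hρ := hP.radius_pos hd
  rw [hde.norm_sub, hdf.norm_sub, sub_sub_sub_cancel_right, hef.norm_sub] at h1
  symm
  apply tangentAngle_eq_of_cos (by positivity) (by positivity) h0 hπ
  linarith

/-! ### Neighbour sequences -/

namespace IsNeighbourSequence

variable {P : Set Disc} {d : Disc} {n : ℕ} {D : Fin n → Disc}

theorem turn_succ (hD : IsNeighbourSequence P d D) (hP : IsPacking c6 P) (hd : d ∈ P) (i : Fin n) :
    Turn ((D i).center - d.center) ((D (finRotate n i)).center - d.center)
      (d.angle (D i) (D (finRotate n i))) :=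
  turn_arg (hP.norm_sub_ne_zero hd (hD.mem i) (hD.tangent i)) _

theorem angle_eq (hD : IsNeighbourSequence P d D) (hP : IsPacking c6 P) (hd : d ∈ P) (i : Fin n) :
    d.angle (D i) (D (finRotate n i)) =
      tangentAngle d.radius (D i).radius (D (finRotate n i)).radius :=
  hP.eq_tangentAngle hd (hD.mem i) (hD.mem _) (hD.tangent_succ i) (hD.tangent i) (hD.tangent _)
    (hD.angle_pos i).le (Complex.arg_le_pi _) (hD.turn_succ hP hd i)

theorem length_pos (hD : IsNeighbourSequence P d D) : 0 < n := by
  rcases Nat.eq_zero_or_pos n with rfl | h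
  · have := hD.angle_sum
    simp [Real.pi_ne_zero] at this
  · exact h

/-- Every direction lies in one of the sectors between successive discs of a neighbour sequence:
among the discs of the sequence, the one with the smallest turn counterclockwise to the given
direction bounds such a sector. -/
theorem exists_sector (hD : IsNeighbourSequence P d D) (hP : IsPacking c6 P) (hd : d ∈ P)
    {v : ℂ} (hv : v ≠ 0) : ∃ (i : Fin n) (τ : ℝ), 0 ≤ τ ∧
      τ < d.angle (D i) (D (finRotate n i)) ∧ Turn ((D i).center - d.center) v τ := by
  have hne : ∀ i, (D i).center - d.center ≠ 0 := fun i =>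
    hP.norm_sub_ne_zero hd (hD.mem i) (hD.tangent i)
  choose φ h0 h2 hφ using fun i => exists_turn (hne i) v
  have : Nonempty (Fin n) := ⟨⟨0, hD.length_pos⟩⟩
  obtain ⟨i, hi⟩ := Finite.exists_min φ
  refine ⟨i, φ i, h0 i, ?_, hφ i⟩
  by_contra! hle
  have hpos := hD.angle_pos i
  have ht := (hD.turn_succ hP hd i).sub (hφ i) (hne i)
  have heq := ht.unique (hφ _) (hne _) hv
    (by rw [abs_lt]; constructor <;> linarith [h0 (finRotate n i), h2 (finRotate n i), h2 i])
  linarith [hi (finRotate n i)]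

end IsNeighbourSequence

/-! ### Possible neighbour sequences -/

/-- The number of indices `i` at which the cyclic word `f` takes the value `p` while its value
at the successor of `i` is `q`. -/
def pairCount {n : ℕ} (f : Fin n → Bool) (p q : Bool) : ℕ :=
  (Finset.univ.filter fun i => f i = p ∧ f (finRotate n i) = q).card

/-- A cyclic word has as many ascents as descents. -/
theorem pairCount_comm {n : ℕ} (f : Fin n → Bool) :
    pairCount f true false = pairCount f false true := by
  have h1 : ∑ i, (if f (finRotate n i) = true then 1 else 0) = ∑ i, if f i = true then 1 else 0 :=
    Equiv.sum_comp (finRotate n) fun i => if f i = true then 1 else 0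
  have h2 : ∀ i, (if f i = true then 1 else 0)
      + (if f i = false ∧ f (finRotate n i) = true then 1 else 0)
      = (if f (finRotate n i) = true then 1 else 0)
      + (if f i = true ∧ f (finRotate n i) = false then 1 else 0) := by
    intro i
    cases f i <;> cases f (finRotate n i) <;> rfl
  have h3 := Finset.sum_congr (rfl : (Finset.univ : Finset (Fin n)) = _) fun i _ => h2 i
  rw [Finset.sum_add_distrib, Finset.sum_add_distrib, h1, ← Finset.card_filter,
    ← Finset.card_filter, ← Finset.card_filter] at h3
  unfold pairCount
  omega

theorem sum_eq_pairCount {n : ℕ} (f : Fin n → Bool) (θ : Bool → Bool → ℝ)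
    (hθ : θ true false = θ false true) :
    ∑ i, θ (f i) (f (finRotate n i)) = pairCount f true true * θ true true
      + 2 * pairCount f true false * θ true false + pairCount f false false * θ false false := by
  have h : ∀ i, θ (f i) (f (finRotate n i))
      = (if f i = true ∧ f (finRotate n i) = true then 1 else 0) * θ true true
      + (if f i = true ∧ f (finRotate n i) = false then 1 else 0) * θ true false
      + (if f i = false ∧ f (finRotate n i) = true then 1 else 0) * θ true false
      + (if f i = false ∧ f (finRotate n i) = false then 1 else 0) * θ false false := by
    intro i
    cases f i <;> cases f (finRotate n i) <;> simp [hθ]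
  simp_rw [h, Finset.sum_add_distrib, ← Finset.sum_mul, ← Nat.cast_one (R := ℝ),
    ← Nat.cast_zero (R := ℝ), ← Nat.cast_ite, ← Nat.cast_sum, ← Finset.card_filter]
  have := pairCount_comm f
  unfold pairCount at *
  rw [this]
  ring

/-- The length of a cyclic word in terms of its numbers of pairs, with ascents counted as
descents. -/
theorem length_eq_pairCount {n : ℕ} (f : Fin n → Bool) :
    n = pairCount f true true + 2 * pairCount f true false + pairCount f false false := by
  have := sum_eq_pairCount f (fun _ _ => 1) rfl
  simp at this
  exact_mod_cast this

theorem ne_of_pairCount_eq_zero {n : ℕ} {f : Fin n → Bool} {p q : Bool} (h : pairCount f p q = 0)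
    (i : Fin n) : ¬(f i = p ∧ f (finRotate n i) = q) := by
  rw [pairCount, Finset.card_eq_zero, Finset.filter_eq_empty_iff] at h
  exact h (Finset.mem_univ i)

theorem finRotate_mk {n k : ℕ} (hk : k + 1 < n) :
    finRotate n ⟨k, by omega⟩ = ⟨k + 1, hk⟩ := by
  obtain _ | n := n
  · omega
  · exact finRotate_of_lt (by omega)

theorem eq_of_pairCount_eq_zero {n : ℕ} {f : Fin n → Bool} (h : pairCount f true false = 0)
    (i j : Fin n) : f i = f j := by
  have h' := h
  rw [pairCount_comm] at h'
  have hs : ∀ i, f (finRotate n i) = f i := by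
    intro i
    have h1 := ne_of_pairCount_eq_zero h i
    have h2 := ne_of_pairCount_eq_zero h' i
    cases hi : f i <;> cases hj : f (finRotate n i) <;> simp_all
  obtain _ | n := n
  · exact i.elim0
  have h0 : ∀ k (hk : k < n + 1), f ⟨k, hk⟩ = f 0 := by
    intro k
    induction k with
    | zero => intro _; rfl
    | succ k ih =>
      intro hk
      rw [← ih (by omega), ← hs ⟨k, by omega⟩, finRotate_mk hk]
  exact (h0 i i.2).trans (h0 j j.2).symm

theorem isRotated_of_pairCount (f : Fin 5 → Bool) (h1 : pairCount f false false = 1)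
    (h2 : pairCount f true false = 2) :
    (List.ofFn f).IsRotated [true, false, false, true, false] := by
  revert f
  decide

/-- The radius of a disc that is large or not. -/
noncomputable def radiusOf (b : Bool) : ℝ := if b then 1 else c6

/-- Whether a disc is large, as a Boolean: finite cyclic words can then be handled by `decide`. -/
noncomputable def Disc.isLarge (d : Disc) : Bool := open Classical in decide (d.radius = 1)

theorem IsPacking.radius_eq_radiusOf {P : Set Disc} (hP : IsPacking c6 P) {d : Disc}
    (hd : d ∈ P) : d.radius = radiusOf d.isLarge := by
  rcases hP.radius_eq d hd with h | h <;> simp [radiusOf, Disc.isLarge, h, one_ne_c6.symm]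

namespace IsNeighbourSequence

variable {P : Set Disc} {d : Disc} {n : ℕ} {D : Fin n → Disc}

theorem sum_tangentAngle (hD : IsNeighbourSequence P d D) (hP : IsPacking c6 P) (hd : d ∈ P) :
    pairCount (fun i => (D i).isLarge) true true * tangentAngle d.radius 1 1
    + 2 * pairCount (fun i => (D i).isLarge) true false * tangentAngle d.radius 1 c6
    + pairCount (fun i => (D i).isLarge) false false * tangentAngle d.radius c6 c6
      = 2 * Real.pi := by
  rw [← hD.angle_sum, eq_comm]
  convert sum_eq_pairCount (fun i => (D i).isLarge)
    (fun p q => tangentAngle d.radius (radiusOf p) (radiusOf q)) (tangentAngle_comm _ _ _) using 2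
  · rename_i i _
    rw [hD.angle_eq hP hd, hP.radius_eq_radiusOf (hD.mem i), hP.radius_eq_radiusOf (hD.mem _)]
  · simp [radiusOf]
  · simp [radiusOf]

/-- Around a small disc the angles are `60°`, `75°` and one between `90°` and `97.5°`; the only
ways to reach `360°` are six times `60°`, and `60°` with four times `75°`. -/
theorem pairCount_of_small (hD : IsNeighbourSequence P d D) (hP : IsPacking c6 P) (hd : d ∈ P)
    (hs : d.radius = c6) :
    pairCount (fun i => (D i).isLarge) true true = 0 ∧
      ((pairCount (fun i => (D i).isLarge) true false = 0 ∧
        pairCount (fun i => (D i).isLarge) false false = 6) ∨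
      (pairCount (fun i => (D i).isLarge) true false = 2 ∧
        pairCount (fun i => (D i).isLarge) false false = 1)) := by
  have h := hD.sum_tangentAngle hP hd
  rw [hs, tangentAngle_small_large_large, tangentAngle_small_large_small,
    tangentAngle_self c6_pos] at h
  generalize pairCount (fun i => (D i).isLarge) true true = c at *
  generalize pairCount (fun i => (D i).isLarge) true false = m at *
  generalize pairCount (fun i => (D i).isLarge) false false = a at *
  have hpi := Real.pi_pos
  obtain ⟨α, hα⟩ : ∃ α, mixedAngle = α * Real.pi :=
    ⟨mixedAngle / Real.pi, by field_simp⟩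
  have h1 := mixedAngle_lt
  have h2 := lt_mixedAngle
  rw [hα] at h h1 h2
  have h1 : α < 1 / 4 := by nlinarith
  have h2 : 11 / 48 < α := by nlinarith
  have h : (c : ℝ) * (1 - 2 * α) + m * (5 / 6) + a / 3 = 2 := by
    apply mul_right_cancel₀ hpi.ne'
    linear_combination h
  have hc : (0 : ℝ) ≤ c * (1 - 2 * α) := mul_nonneg (by positivity) (by linarith)
  have hm : m < 3 := by
    have : (m : ℝ) < 3 := by linarith [(Nat.cast_nonneg a : (0 : ℝ) ≤ a)]
    exact_mod_cast this
  have hc : c < 4 := by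
    have : (c : ℝ) < 4 := by
      nlinarith [(Nat.cast_nonneg a : (0 : ℝ) ≤ a), (Nat.cast_nonneg m : (0 : ℝ) ≤ m)]
    exact_mod_cast this
  have ha : a < 7 := by
    have : (a : ℝ) < 7 := by
      nlinarith [(Nat.cast_nonneg m : (0 : ℝ) ≤ m)]
    exact_mod_cast this
  interval_cases m <;> interval_cases c <;> interval_cases a <;>
    first
    | exact ⟨rfl, Or.inl ⟨rfl, rfl⟩⟩
    | exact ⟨rfl, Or.inr ⟨rfl, rfl⟩⟩
    | (exfalso; push_cast at h; linarith)

/-- Around a large disc the angles are `60°`, `30°` and one between `41.25°` and `45°`, which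
occurs an even number of times; to reach `360°` it cannot occur at all. -/
theorem pairCount_of_large (hD : IsNeighbourSequence P d D) (hP : IsPacking c6 P) (hd : d ∈ P)
    (hs : d.radius = 1) :
    pairCount (fun i => (D i).isLarge) true false = 0 ∧
      2 * pairCount (fun i => (D i).isLarge) true true +
        pairCount (fun i => (D i).isLarge) false false = 12 := by
  have h := hD.sum_tangentAngle hP hd
  rw [hs, tangentAngle_large_large_small, tangentAngle_large_small_small,
    tangentAngle_self one_pos] at h
  generalize pairCount (fun i => (D i).isLarge) true true = c at *
  generalize pairCount (fun i => (D i).isLarge) true false = m at *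
  generalize pairCount (fun i => (D i).isLarge) false false = a at *
  have hpi := Real.pi_pos
  obtain ⟨α, hα⟩ : ∃ α, mixedAngle = α * Real.pi :=
    ⟨mixedAngle / Real.pi, by field_simp⟩
  have h1 := mixedAngle_lt
  have h2 := lt_mixedAngle
  rw [hα] at h h1 h2
  have h1 : α < 1 / 4 := by nlinarith
  have h2 : 11 / 48 < α := by nlinarith
  have h : ((2 * c + a : ℕ) : ℝ) = 12 - 12 * m * α := by
    push_cast
    apply mul_right_cancel₀ hpi.ne'
    linear_combination 6 * h
  generalize 2 * c + a = k at *
  have hm : m < 5 := by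
    have : (m : ℝ) < 5 := by
      have : (0 : ℝ) ≤ k := by positivity
      nlinarith [(Nat.cast_nonneg m : (0 : ℝ) ≤ m)]
    exact_mod_cast this
  interval_cases m
  · exact ⟨rfl, by push_cast at h; exact_mod_cast (by linarith : (k : ℝ) = 12)⟩
  all_goals exfalso; push_cast at h
  · have h3 : (9 : ℝ) < k := by linarith
    have h4 : (k : ℝ) < 10 := by linarith
    norm_cast at h3 h4; omega
  · have h3 : (6 : ℝ) < k := by linarith
    have h4 : (k : ℝ) < 7 := by linarith
    norm_cast at h3 h4; omega
  · have h3 : (3 : ℝ) < k := by linarith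
    have h4 : (k : ℝ) < 4 := by linarith
    norm_cast at h3 h4; omega
  · have h3 : (0 : ℝ) < k := by linarith
    have h4 : (k : ℝ) < 1 := by linarith
    norm_cast at h3 h4; omega

end IsNeighbourSequence

namespace IsNeighbourSequence

variable {P : Set Disc} {d : Disc} {n : ℕ} {D : Fin n → Disc}

/-- The radii of a disc and of two successive discs of a neighbour sequence. -/
theorem sector_cases (hD : IsNeighbourSequence P d D) (hP : IsPacking c6 P) (hd : d ∈ P)
    (i : Fin n) :
    (d.radius = c6 ∧ (D i).radius = c6 ∧ (D (finRotate n i)).radius = c6) ∨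
    (d.radius = c6 ∧ (D i).radius = 1 ∧ (D (finRotate n i)).radius = c6) ∨
    (d.radius = c6 ∧ (D i).radius = c6 ∧ (D (finRotate n i)).radius = 1) ∨
    (d.radius = 1 ∧ (D i).radius = c6 ∧ (D (finRotate n i)).radius = c6) ∨
    (d.radius = 1 ∧ (D i).radius = 1 ∧ (D (finRotate n i)).radius = 1) := by
  have hx := hP.radius_eq_radiusOf (hD.mem i)
  have hy := hP.radius_eq_radiusOf (hD.mem (finRotate n i))
  rcases hP.radius_eq d hd with h | h
  · have h1 := eq_of_pairCount_eq_zero (hD.pairCount_of_large hP hd h).1 i (finRotate n i)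
    rw [h, hx, hy, ← h1]
    cases (D i).isLarge <;> simp [radiusOf]
  · have h1 := ne_of_pairCount_eq_zero (hD.pairCount_of_small hP hd h).1 i
    rw [h, hx, hy]
    cases h2 : (D i).isLarge <;> cases h3 : (D (finRotate n i)).isLarge
    · simp [radiusOf]
    · simp [radiusOf]
    · simp [radiusOf]
    · exact absurd ⟨h2, h3⟩ h1

/-- A sector is too narrow for a further disc of a packing between the two discs that bound it. -/
theorem angle_lt_add (hD : IsNeighbourSequence P d D) (hP : IsPacking c6 P) (hd : d ∈ P)
    (i : Fin n) {e : Disc} (he : e ∈ P) :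
    tangentAngle d.radius (D i).radius (D (finRotate n i)).radius <
      tangentAngle d.radius (D i).radius e.radius +
        tangentAngle d.radius e.radius (D (finRotate n i)).radius := by
  have h1 := mixedAngle_lt
  have h2 := lt_mixedAngle
  have h3 := Real.pi_pos
  have h4 := tangentAngle_comm c6 c6 1
  have h5 := tangentAngle_comm 1 c6 1
  have h6 := tangentAngle_small_large_large
  have h7 := tangentAngle_small_large_small
  have h8 := tangentAngle_self c6_pos
  have h9 := tangentAngle_self one_pos
  have h10 := tangentAngle_large_small_small
  have h11 := tangentAngle_large_large_small
  rcases hD.sector_cases hP hd i with ⟨a, b, c⟩ | ⟨a, b, c⟩ | ⟨a, b, c⟩ | ⟨a, b, c⟩ | ⟨a, b, c⟩ <;>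
    rcases hP.radius_eq e he with h | h <;> rw [a, b, c, h] <;> linarith

/-- A neighbour sequence of `d` contains every disc of the packing that touches `d`. -/
theorem mem_range (hD : IsNeighbourSequence P d D) (hP : IsPacking c6 P) (hd : d ∈ P)
    {e : Disc} (he : e ∈ P) (hde : d.Tangent e) : e ∈ Set.range D := by
  by_contra hn
  have hne : ∀ i, D i ≠ e := fun i hi => hn ⟨i, hi⟩
  obtain ⟨i, τ, h0, hlt, ht⟩ := hD.exists_sector hP hd (hP.norm_sub_ne_zero hd he hde)
  have hθ := Complex.arg_le_pi
    (((D (finRotate n i)).center - d.center) / ((D i).center - d.center))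
  have h1 := hP.tangentAngle_le hd (hD.mem i) he (hne i) (hD.tangent i) hde h0
    (hlt.le.trans hθ) ht
  have h2 := hP.tangentAngle_le hd he (hD.mem (finRotate n i)) (hne _).symm hde (hD.tangent _)
    (τ := d.angle (D i) (D (finRotate n i)) - τ) (by linarith)
    (by unfold Disc.angle at *; linarith)
    (ht.sub (hD.turn_succ hP hd i) (hP.norm_sub_ne_zero hd (hD.mem i) (hD.tangent i)))
  have h3 := hD.angle_lt_add hP hd i he
  have h4 := hD.angle_eq hP hd i
  linarith

theorem range_eq (hD : IsNeighbourSequence P d D) (hP : IsPacking c6 P) (hd : d ∈ P) :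
    Set.range D = {e | e ∈ P ∧ d.Tangent e} := by
  ext e
  constructor
  · rintro ⟨i, rfl⟩
    exact ⟨hD.mem i, hD.tangent i⟩
  · rintro ⟨he, hde⟩
    exact hD.mem_range hP hd he hde

/-- The turn from one disc of the sequence to a later one is a proper partial sum of the angles,
hence strictly between `0` and `2 π`. -/
theorem injective (hD : IsNeighbourSequence P d D) (hP : IsPacking c6 P) (hd : d ∈ P) :
    Function.Injective D := by
  have hne : ∀ i, (D i).center - d.center ≠ 0 := fun i =>
    hP.norm_sub_ne_zero hd (hD.mem i) (hD.tangent i)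
  obtain ⟨θ, hθ⟩ : ∃ θ : ℕ → ℝ, ∀ i : Fin n, θ i = d.angle (D i) (D (finRotate n i)) :=
    ⟨fun k => if h : k < n then d.angle (D ⟨k, h⟩) (D (finRotate n ⟨k, h⟩)) else 0, by simp⟩
  have hsum : ∑ k ∈ Finset.range n, θ k = 2 * Real.pi := by
    rw [← hD.angle_sum, ← Fin.sum_univ_eq_sum_range]
    exact Finset.sum_congr rfl fun i _ => hθ i
  have hpos : ∀ k < n, 0 < θ k := fun k hk => by
    rw [hθ ⟨k, hk⟩]; exact hD.angle_pos _
  have hturn : ∀ k l (hkl : k ≤ l) (hl : l < n),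
      Turn ((D ⟨k, by omega⟩).center - d.center) ((D ⟨l, hl⟩).center - d.center)
        (∑ j ∈ Finset.Ico k l, θ j) := by
    intro k l hkl
    induction l, hkl using Nat.le_induction with
    | base => intro hl; simp [Turn]
    | succ l hkl ih =>
      intro hl
      rw [Finset.sum_Ico_succ_top hkl]
      have := hD.turn_succ hP hd ⟨l, by omega⟩
      rw [← hθ ⟨l, by omega⟩, finRotate_mk hl] at this
      exact (ih (by omega)).add this (hne _)
  have key : ∀ k l (hkl : k < l) (hl : l < n), D ⟨k, by omega⟩ ≠ D ⟨l, hl⟩ := by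
    intro k l hkl hl heq
    have h1 := hturn k l hkl.le hl
    have h2 : 0 < ∑ j ∈ Finset.Ico k l, θ j :=
      Finset.sum_pos (fun j hj => hpos j (by simp at hj; omega)) (by simpa using hkl)
    have h3 : ∑ j ∈ Finset.Ico k l, θ j < ∑ j ∈ Finset.range n, θ j := by
      apply Finset.sum_lt_sum_of_subset (i := l)
      · intro j hj; simp at hj ⊢; omega
      · simpa using hl
      · simp
      · exact hpos l hl
      · intro j hj _; exact (hpos j (by simpa using hj)).le
    rw [← heq] at h1
    have h4 : Turn ((D ⟨k, by omega⟩).center - d.center) ((D ⟨k, by omega⟩).center - d.center)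
        0 := by simp [Turn]
    have := h1.unique h4 (hne _) (hne _) (by rw [sub_zero, abs_of_pos h2, ← hsum]; exact h3)
    linarith
  intro i j hij
  rcases lt_trichotomy i.1 j.1 with h | h | h
  · exact (key i j h j.2 hij).elim
  · exact Fin.ext h
  · exact (key j i h i.2 hij.symm).elim

end IsNeighbourSequence

/-! ### Connectedness of compact packings -/

/-- A point of the sector spanned by the sides `a` and `b` of a triangle with vertex `0` that is
at least as close to `0` as to the two other vertices is not farther from `0` than the
circumcentre. -/
theorem norm_mul_sin_le {a b v : ℂ} {θ τ : ℝ} (ha : a ≠ 0) (hb : b ≠ 0) (hab : Turn a b θ)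
    (hv : Turn a v τ) (h0 : 0 ≤ τ) (hτ : τ ≤ θ) (hπ : θ ≤ Real.pi) (hva : ‖v‖ ≤ ‖v - a‖)
    (hvb : ‖v‖ ≤ ‖v - b‖) : 2 * ‖v‖ * Real.sin θ ≤ ‖b - a‖ := by
  have ha' : 0 < ‖a‖ := by simpa
  have hb' : 0 < ‖b‖ := by simpa
  have h1 := hv.norm_sub_sq ha
  have h2 := (hab.sub hv ha).norm_sub_sq hb
  have h3 := hab.norm_sub_sq ha
  have h4 : 2 * ‖v‖ * Real.cos τ ≤ ‖a‖ := by
    have := pow_le_pow_left₀ (norm_nonneg v) hva 2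
    rw [h1] at this
    apply le_of_mul_le_mul_left _ ha'
    linarith
  have h5 : 2 * ‖v‖ * Real.cos (θ - τ) ≤ ‖b‖ := by
    have := pow_le_pow_left₀ (norm_nonneg v) hvb 2
    rw [h2, ← Real.cos_neg, neg_sub] at this
    apply le_of_mul_le_mul_left _ hb'
    linarith
  have h6 : 0 ≤ Real.sin τ := Real.sin_nonneg_of_nonneg_of_le_pi h0 (hτ.trans hπ)
  have h7 : 0 ≤ Real.sin (θ - τ) :=
    Real.sin_nonneg_of_nonneg_of_le_pi (by linarith) (by linarith)
  have h8 : 2 * ‖v‖ * Real.sin θ ≤ ‖a‖ * Real.sin (θ - τ) + ‖b‖ * Real.sin τ := by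
    rw [show θ = τ + (θ - τ) by ring, Real.sin_add, show τ + (θ - τ) - τ = θ - τ by ring]
    nlinarith [mul_le_mul_of_nonneg_right h4 h7, mul_le_mul_of_nonneg_right h5 h6]
  refine h8.trans ?_
  apply le_of_sq_le_sq _ (norm_nonneg _)
  have h9 : ‖b - a‖ ^ 2 - (‖a‖ * Real.sin (θ - τ) + ‖b‖ * Real.sin τ) ^ 2
      = (‖a‖ * Real.cos (θ - τ) - ‖b‖ * Real.cos τ) ^ 2 := by
    rw [h3, Real.sin_sub, Real.cos_sub]
    linear_combination -(‖a‖ ^ 2 * (Real.sin θ ^ 2 + Real.cos θ ^ 2) + ‖b‖ ^ 2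
      - 2 * ‖a‖ * ‖b‖ * Real.cos θ) * Real.sin_sq_add_cos_sq τ
      - ‖a‖ ^ 2 * Real.sin_sq_add_cos_sq θ
  linarith [sq_nonneg (‖a‖ * Real.cos (θ - τ) - ‖b‖ * Real.cos τ)]

/-- The circumradius of a triangle of centres that occurs in a compact packing is at most `ρ + c₆`,
where `ρ` is the radius of any of its discs. -/
theorem IsNeighbourSequence.le_add_c6 {P : Set Disc} {d : Disc} {n : ℕ} {D : Fin n → Disc}
    (hD : IsNeighbourSequence P d D) (hP : IsPacking c6 P) (hd : d ∈ P) (i : Fin n) {R : ℝ}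
    (h : 2 * R * Real.sin (d.angle (D i) (D (finRotate n i))) ≤
      (D i).radius + (D (finRotate n i)).radius) : R ≤ d.radius + c6 := by
  rw [hD.angle_eq hP hd] at h
  have hr := c6_bounds
  have h3 := sqrt_three_bounds
  -- `2 sin 75° · 2 sin 15° = 1` makes the circumradius of a triangle of radii `1`, `c₆`, `c₆`
  -- equal to `2 c₆`.
  have h75 : c6 * (2 * Real.sin (5 * Real.pi / 12)) * 2 = 1 + c6 := by
    have h1 := Real.sin_two_mul (Real.pi / 12)
    rw [show 2 * (Real.pi / 12) = Real.pi / 6 by ring, Real.sin_pi_div_six] at h1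
    rw [show 5 * Real.pi / 12 = Real.pi / 2 - Real.pi / 12 by ring, Real.sin_pi_div_two_sub]
    linear_combination 4 * Real.cos (Real.pi / 12) * c6_eq - 2 * (1 + c6) * h1
  have hs : 0 < Real.sin (5 * Real.pi / 12) :=
    Real.sin_pos_of_pos_of_lt_pi (by positivity) (by linarith [Real.pi_pos])
  rcases hD.sector_cases hP hd i with ⟨a, b, c⟩ | ⟨a, b, c⟩ | ⟨a, b, c⟩ | ⟨a, b, c⟩ | ⟨a, b, c⟩ <;>
    rw [a, b, c] at h <;> rw [a]
  · rw [tangentAngle_self c6_pos, Real.sin_pi_div_three] at h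
    nlinarith
  · rw [tangentAngle_small_large_small] at h
    nlinarith
  · rw [tangentAngle_comm, tangentAngle_small_large_small] at h
    nlinarith
  · rw [tangentAngle_large_small_small, Real.sin_pi_div_six] at h
    linarith
  · rw [tangentAngle_self one_pos, Real.sin_pi_div_three] at h
    nlinarith

/-- The graph of tangencies of a compact packing is connected. Let `d ∈ S` have its centre
closest to that of a disc `e ∉ S`. The two neighbours of `d` that bound the sector of `e` are not
closer, so that the distance is at most a circumradius, which leaves no room for `e`. -/
theorem IsCompactPacking.eq_of_tangent_mem {P S : Set Disc} (hP : IsCompactPacking c6 P)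
    (hS : S ⊆ P) (hne : S.Nonempty) (hcl : ∀ d ∈ S, ∀ e ∈ P, d.Tangent e → e ∈ S) : S = P := by
  have hpack := hP.toIsPacking
  refine hS.antisymm fun e he => ?_
  by_contra heS
  have hclosed : IsClosed (Disc.center '' S) := by
    apply Metric.isClosed_of_pairwise_le_dist (ε := c6) c6_pos
    rintro _ ⟨x, hx, rfl⟩ _ ⟨y, hy, rfl⟩ hxy
    have h1 := hpack.radius_add_le_dist (hS hx) (hS hy) fun h => hxy (by rw [h])
    linarith [hpack.c6_le_radius (hS hx), hpack.radius_pos (hS hy)]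
  obtain ⟨_, ⟨d, hd, rfl⟩, hmin⟩ := hclosed.exists_infDist_eq_dist (hne.image _) e.center
  have hmin' : ∀ x ∈ S, ‖e.center - d.center‖ ≤ ‖e.center - x.center‖ := fun x hx => by
    rw [← dist_eq_norm, ← dist_eq_norm, ← hmin]
    exact Metric.infDist_le_dist_of_mem ⟨x, hx, rfl⟩
  have hdP := hS hd
  have hde := hpack.radius_add_le_dist hdP he fun h => heS (h ▸ hd)
  rw [dist_comm, dist_eq_norm] at hde
  have hrd := hpack.radius_pos hdP
  have hre := hpack.c6_le_radius he
  have hr := c6_pos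
  have hv : e.center - d.center ≠ 0 := by rw [← norm_pos_iff]; linarith
  obtain ⟨n, D, hD⟩ := hP.surrounded d hdP
  have hDne : ∀ i, (D i).center - d.center ≠ 0 := fun i =>
    hpack.norm_sub_ne_zero hdP (hD.mem i) (hD.tangent i)
  obtain ⟨i, τ, h0, hlt, ht⟩ := hD.exists_sector hpack hdP hv
  have hDS : ∀ i, ‖e.center - d.center‖
      ≤ ‖e.center - d.center - ((D i).center - d.center)‖ := fun i => by
    rw [sub_sub_sub_cancel_right]
    exact hmin' _ (hcl d hd _ (hD.mem i) (hD.tangent i))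
  have h1 := norm_mul_sin_le (hDne i) (hDne _) (hD.turn_succ hpack hdP i) ht h0 hlt.le
    (Complex.arg_le_pi _) (hDS i) (hDS _)
  rw [sub_sub_sub_cancel_right, (hD.tangent_succ i).norm_sub] at h1
  have h2 := hD.le_add_c6 hpack hdP i h1
  -- Only tangency is left, and it is excluded as `S` is closed under tangency.
  refine heS (hcl d hd e he ?_)
  rw [Disc.Tangent, dist_comm, dist_eq_norm]
  linarith

/-! ### The neighbours of the discs of a compact packing -/

/-- In a compact packing no two large discs touch: otherwise every large disc would touch only
large discs, and by connectedness there would be no small one. -/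
theorem IsCompactPacking.radius_eq_c6_of_tangent {P : Set Disc} (hP : IsCompactPacking c6 P)
    {d e : Disc} (hd : d ∈ P) (he : e ∈ P) (hde : d.Tangent e) (hd1 : d.radius = 1) :
    e.radius = c6 := by
  have hpack := hP.toIsPacking
  by_contra hne
  have he1 : e.radius = 1 := (hpack.radius_eq e he).resolve_right hne
  have hS := hP.eq_of_tangent_mem
    (S := {x | x ∈ P ∧ x.radius = 1 ∧ ∃ y ∈ P, x.Tangent y ∧ y.radius = 1}) (fun x hx => hx.1)
    ⟨d, hd, hd1, e, he, hde, he1⟩ (by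
      rintro x ⟨hx, hx1, y, hy, hxy, hy1⟩ z hz hxz
      obtain ⟨n, D, hD⟩ := hP.surrounded x hx
      obtain ⟨i, rfl⟩ := hD.mem_range hpack hx hy hxy
      obtain ⟨j, rfl⟩ := hD.mem_range hpack hx hz hxz
      have h := eq_of_pairCount_eq_zero (hD.pairCount_of_large hpack hx hx1).1 j i
      have hj : (D j).radius = 1 := by
        rw [hpack.radius_eq_radiusOf hz, h, ← hpack.radius_eq_radiusOf hy, hy1]
      exact ⟨hz, hj, x, hx, hxz.symm, hx1⟩)
  obtain ⟨x, hx, hxr⟩ := hP.exists_small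
  rw [← hS] at hx
  exact one_ne_c6 (hx.2.1.symm.trans hxr)

theorem eq_true_or_of_pairCount (f : Fin 5 → Bool) (h1 : pairCount f false false = 1)
    (h2 : pairCount f true false = 2) (j : Fin 5) (hj : f j = false) :
    f (finRotate 5 j) = true ∨ f ((finRotate 5).symm j) = true := by
  revert f j
  decide

theorem IsNeighbourSequence.pairCount_of_large_mem {P : Set Disc} {d : Disc} {n : ℕ}
    {D : Fin n → Disc} (hD : IsNeighbourSequence P d D) (hP : IsPacking c6 P) (hd : d ∈ P)
    (hs : d.radius = c6) {i : Fin n} (hi : (D i).radius = 1) :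
    n = 5 ∧ pairCount (fun i => (D i).isLarge) false false = 1 ∧
      pairCount (fun i => (D i).isLarge) true false = 2 := by
  have hn := length_eq_pairCount fun i => (D i).isLarge
  obtain ⟨h0, ⟨h1, h2⟩ | ⟨h1, h2⟩⟩ := hD.pairCount_of_small hP hd hs
  · have hi' : (D i).isLarge = true := by simp [Disc.isLarge, hi]
    have h3 := eq_of_pairCount_eq_zero h1 i (finRotate n i)
    exact absurd ⟨hi', h3 ▸ hi'⟩ (ne_of_pairCount_eq_zero h0 i)
  · exact ⟨by omega, h2, h1⟩

/-- In a compact packing every small disc touches a large one. The small discs without large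
neighbours touch only discs of the same kind, as in the sequence `1, c₆, c₆, 1, c₆` each small disc
is next to a large one. -/
theorem IsCompactPacking.exists_large_tangent {P : Set Disc} (hP : IsCompactPacking c6 P)
    {d : Disc} (hd : d ∈ P) (hdr : d.radius = c6) :
    ∃ e ∈ P, d.Tangent e ∧ e.radius = 1 := by
  have hpack := hP.toIsPacking
  by_contra! hno
  have hS := hP.eq_of_tangent_mem
    (S := {x | x ∈ P ∧ x.radius = c6 ∧ ∀ y ∈ P, x.Tangent y → y.radius ≠ 1}) (fun x hx => hx.1)
    ⟨d, hd, hdr, hno⟩ (by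
      rintro x ⟨hx, hxr, hxno⟩ y hy hxy
      have hyr := (hpack.radius_eq y hy).resolve_left (hxno y hy hxy)
      refine ⟨hy, hyr, fun z hz hyz hz1 => ?_⟩
      obtain ⟨n, D, hD⟩ := hP.surrounded y hy
      obtain ⟨i, rfl⟩ := hD.mem_range hpack hy hz hyz
      obtain ⟨j, rfl⟩ := hD.mem_range hpack hy hx hxy.symm
      have hsucc := hxno _ (hD.mem (finRotate n j)) (hD.tangent_succ j)
      have hpred : (D ((finRotate n).symm j)).radius ≠ 1 := by
        apply hxno _ (hD.mem _)
        have := (hD.tangent_succ ((finRotate n).symm j)).symm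
        rwa [Equiv.apply_symm_apply] at this
      obtain ⟨rfl, h1, h2⟩ := hD.pairCount_of_large_mem hpack hy hyr hz1
      have hcases := eq_true_or_of_pairCount _ h1 h2 j (by simp [Disc.isLarge, hxr, one_ne_c6.symm])
      rcases hcases with h | h
      · exact hsucc (by simpa [Disc.isLarge] using h)
      · exact hpred (by simpa [Disc.isLarge] using h))
  obtain ⟨x, hx, hxr⟩ := hP.exists_large
  rw [← hS] at hx
  exact one_ne_c6 (hxr.symm.trans hx.2.1)

namespace IsNeighbourSequence

variable {P : Set Disc} {d : Disc} {n : ℕ} {D : Fin n → Disc}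

theorem isRotated_of_small (hD : IsNeighbourSequence P d D) (hP : IsCompactPacking c6 P)
    (hd : d ∈ P) (hs : d.radius = c6) :
    (List.ofFn fun i => (D i).radius).IsRotated [1, c6, c6, 1, c6] := by
  have hpack := hP.toIsPacking
  obtain ⟨e, he, hde, he1⟩ := hP.exists_large_tangent hd hs
  obtain ⟨i, rfl⟩ := hD.mem_range hpack hd he hde
  obtain ⟨rfl, h1, h2⟩ := hD.pairCount_of_large_mem hpack hd hs he1
  have h := (isRotated_of_pairCount _ h1 h2).map radiusOf
  have h3 : (fun i => (D i).radius) = radiusOf ∘ fun i => (D i).isLarge := by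
    funext i
    exact hpack.radius_eq_radiusOf (hD.mem i)
  rw [h3, ← List.map_ofFn]
  simpa [radiusOf] using h

theorem length_eq_of_large (hD : IsNeighbourSequence P d D) (hP : IsCompactPacking c6 P)
    (hd : d ∈ P) (hs : d.radius = 1) : n = 12 := by
  have hpack := hP.toIsPacking
  have hn := length_eq_pairCount fun i => (D i).isLarge
  have hl : ∀ i, (D i).isLarge = false := fun i => by
    have := hP.radius_eq_c6_of_tangent hd (hD.mem i) (hD.tangent i) hs
    simp [Disc.isLarge, this, one_ne_c6.symm]
  have h0 : pairCount (fun i => (D i).isLarge) true true = 0 := by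
    simp [pairCount, hl]
  have := hD.pairCount_of_large hpack hd hs
  omega

theorem radii_of_large (hD : IsNeighbourSequence P d D) (hP : IsCompactPacking c6 P)
    (hd : d ∈ P) (hs : d.radius = 1) :
    (List.ofFn fun i => (D i).radius) = List.replicate 12 c6 := by
  obtain rfl := hD.length_eq_of_large hP hd hs
  rw [← List.ofFn_const]
  congr 1
  funext i
  exact hP.radius_eq_c6_of_tangent hd (hD.mem i) (hD.tangent i) hs

end IsNeighbourSequence

/-! ### Propagation of the hexagonal pattern -/

/-- The unit vector whose argument is `m` times `15°`. -/
noncomputable def dir (m : ℤ) : ℂ := Complex.exp (((m * (Real.pi / 12) : ℝ) : ℂ) * Complex.I)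

theorem norm_dir (m : ℤ) : ‖dir m‖ = 1 := Complex.norm_exp_ofReal_mul_I _

theorem dir_add (m k : ℤ) : dir (m + k) = dir m * dir k := by
  rw [dir, dir, dir, ← Complex.exp_add]
  push_cast
  ring_nf

theorem dir_zero : dir 0 = 1 := by simp [dir]

theorem dir_four : dir 4 = ⟨1 / 2, √3 / 2⟩ := by
  have h : ((4 : ℤ) : ℝ) * (Real.pi / 12) = Real.pi / 3 := by push_cast; ring
  apply Complex.ext
  · simp only [dir, Complex.exp_ofReal_mul_I_re, h, Real.cos_pi_div_three]
  · simp only [dir, Complex.exp_ofReal_mul_I_im, h, Real.sin_pi_div_three]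

/-- `dir 4` is a primitive sixth root of unity. -/
theorem dir_eight : dir 8 = dir 4 - 1 := by
  have h : √3 * √3 = 3 := Real.mul_self_sqrt (by norm_num)
  rw [show (8 : ℤ) = 4 + 4 by norm_num, dir_add, dir_four]
  apply Complex.ext
  · simp
    linear_combination -h / 4
  · simp
    ring

theorem dir_twelve : dir 12 = -1 := by
  rw [dir, ← Complex.exp_pi_mul_I]
  push_cast
  ring_nf

theorem dir_add_twelve (m : ℤ) : dir (m + 12) = -dir m := by
  rw [dir_add, dir_twelve, mul_neg_one]

theorem dir_sub_twelve (m : ℤ) : dir (m - 12) = -dir m := by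
  have := dir_add_twelve (m - 12)
  rw [sub_add_cancel] at this
  rw [this, neg_neg]

theorem dir_re (m : ℤ) : (dir m).re = Real.cos (m * (Real.pi / 12)) :=
  Complex.exp_ofReal_mul_I_re _

theorem dir_im (m : ℤ) : (dir m).im = Real.sin (m * (Real.pi / 12)) :=
  Complex.exp_ofReal_mul_I_im _

/-- The distance between neighbouring points of the lattice. It is the long diagonal of a rhombus
with sides `1 + c₆` and an angle of `30°`, formed by the centres of two large and two small
discs. -/
noncomputable def edgeLength : ℝ := 2 * (1 + c6) * Real.cos (Real.pi / 12)

theorem edgeLength_eq : (edgeLength : ℂ) = (1 + c6) * (dir 1 + dir (-1)) := by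
  apply Complex.ext
  · simp [edgeLength, dir_re, dir_im, -Complex.ofReal_cos]
    ring
  · simp [dir_re, dir_im]

theorem two_mul_c6_eq : (2 * c6 : ℂ) = (1 + c6) * (dir 5 + dir (-5)) := by
  have h : Real.cos (5 * (Real.pi / 12)) = Real.sin (Real.pi / 12) := by
    rw [← Real.cos_pi_div_two_sub]; ring_nf
  have := c6_eq
  apply Complex.ext
  · simp [dir_re, dir_im, h]
    linarith
  · simp [dir_re, dir_im]

theorem Turn.eq_mul_exp {a b : ℂ} {τ : ℝ} (h : Turn a b τ) (ha : a ≠ 0) (hab : ‖a‖ = ‖b‖) :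
    b = a * Complex.exp (τ * Complex.I) := by
  have ha' : (‖a‖ : ℂ) ≠ 0 := by simpa
  apply mul_right_cancel₀ ha'
  rw [h, ← hab]
  ring

/-- The disc of radius `ρ` with centre at distance `1 + c₆` from `c` in the direction of the unit
vector `u`. If `ρ` is one of the two radii, it touches the disc of the other radius about `c`. -/
noncomputable def touching (c u : ℂ) (ρ : ℝ) : Disc := ⟨c + ((1 + c6 : ℝ) : ℂ) * u, ρ⟩

theorem tangent_touching {c u : ℂ} (hu : ‖u‖ = 1) {σ ρ : ℝ} (h : σ + ρ = 1 + c6) :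
    (⟨c, σ⟩ : Disc).Tangent (touching c u ρ) := by
  have := c6_pos
  rw [Disc.Tangent, touching, dist_self_add_right, norm_mul, hu, mul_one, Complex.norm_real, h,
    Real.norm_of_nonneg (by linarith)]

theorem eq_touching_mul_exp {c u : ℂ} (hu : ‖u‖ = 1) {f : Disc} {σ ρ τ : ℝ} (h : σ + ρ = 1 + c6)
    (hf : (⟨c, σ⟩ : Disc).Tangent f) (hfρ : f.radius = ρ)
    (ht : Turn ((touching c u ρ).center - c) (f.center - c) τ) :
    f = touching c (u * Complex.exp (τ * Complex.I)) ρ := by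
  have hr := c6_pos
  have h1 := (tangent_touching (c := c) hu h).norm_sub
  have h2 := hf.norm_sub
  have h3 := ht.eq_mul_exp (by rw [← norm_pos_iff]; rw [h1]; simp [touching]; linarith)
    (by rw [h1, h2, hfρ]; rfl)
  obtain ⟨f, _⟩ := f
  simp only [touching] at *
  simp only [Disc.mk.injEq]
  refine ⟨?_, hfρ⟩
  linear_combination h3

/-- The small discs around a large disc of a compact packing are `30°` apart. -/
theorem IsCompactPacking.rotate_small {P : Set Disc} (hP : IsCompactPacking c6 P) {c u : ℂ}
    (hu : ‖u‖ = 1) (hc : ⟨c, 1⟩ ∈ P) (hs : touching c u c6 ∈ P) :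
    touching c (u * dir 2) c6 ∈ P := by
  have hpack := hP.toIsPacking
  obtain ⟨n, D, hD⟩ := hP.surrounded _ hc
  obtain ⟨i, hi⟩ := hD.mem_range hpack hc hs (tangent_touching hu rfl)
  have ht := hD.turn_succ hpack hc i
  have hr := hP.radius_eq_c6_of_tangent hc (hD.mem (finRotate n i)) (hD.tangent _) rfl
  rw [hD.angle_eq hpack hc, hr, hi] at ht
  simp only [touching, tangentAngle_large_small_small] at ht
  have h := eq_touching_mul_exp hu rfl (hD.tangent _) hr ht
  have h2 : dir 2 = Complex.exp ((Real.pi / 6 : ℝ) * Complex.I) := by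
    rw [dir]; push_cast; ring_nf
  rw [h2, ← h]
  exact hD.mem _

/-- In a cyclic arrangement of `1, c₆, c₆, 1, c₆` the next large disc after a large one is two or
three steps away. -/
theorem cyclic_pattern (f : Fin 5 → Bool) (h1 : pairCount f false false = 1)
    (h2 : pairCount f true false = 2) (j : Fin 5) (hj : f j = true) :
    f (finRotate 5 j) = false ∧ (f (finRotate 5 (finRotate 5 j)) = true ∨
      f (finRotate 5 (finRotate 5 j)) = false ∧
        f (finRotate 5 (finRotate 5 (finRotate 5 j))) = true) := by
  revert f j
  decide

/-- The two large discs that touch a small disc of a compact packing are seen from its centre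
under the angle `150°`. -/
theorem IsCompactPacking.rotate_large {P : Set Disc} (hP : IsCompactPacking c6 P) {c u : ℂ}
    (hu : ‖u‖ = 1) (hc : ⟨c, c6⟩ ∈ P) (hs : touching c u 1 ∈ P) :
    touching c (u * dir 10) 1 ∈ P ∨ touching c (u * dir (-10)) 1 ∈ P := by
  have hpack := hP.toIsPacking
  obtain ⟨n, D, hD⟩ := hP.surrounded _ hc
  obtain ⟨i, hi⟩ := hD.mem_range hpack hc hs (tangent_touching hu (add_comm _ _))
  obtain ⟨rfl, h1, h2⟩ := hD.pairCount_of_large_mem hpack hc rfl (i := i) (by rw [hi]; rfl)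
  have hrad : ∀ j, (D j).radius = radiusOf (D j).isLarge := fun j =>
    hpack.radius_eq_radiusOf (hD.mem j)
  have hne : ∀ j, (D j).center - c ≠ 0 := fun j =>
    hpack.norm_sub_ne_zero hc (hD.mem j) (hD.tangent j)
  have hi1 : (D i).isLarge = true := by simp [hi, touching, Disc.isLarge]
  have ht : ∀ j, Turn ((D j).center - c) ((D (finRotate 5 j)).center - c)
      (tangentAngle c6 (radiusOf (D j).isLarge) (radiusOf (D (finRotate 5 j)).isLarge)) := by
    intro j
    have h := hD.turn_succ hpack hc j
    rw [hD.angle_eq hpack hc, hrad j, hrad (finRotate 5 j)] at h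
    exact h
  have t1 := ht i
  have t2 := ht (finRotate 5 i)
  have t3 := ht (finRotate 5 (finRotate 5 i))
  have e1 := tangentAngle_small_large_small
  have e2 := tangentAngle_comm c6 c6 1
  have e3 := tangentAngle_self c6_pos
  rw [e1] at e2
  obtain ⟨p1, p2 | ⟨p2, p3⟩⟩ := cyclic_pattern _ h1 h2 i hi1
  · left
    rw [hi1, p1] at t1
    rw [p1, p2] at t2
    simp only [radiusOf, e1, e2, if_true, Bool.false_eq_true, if_false] at t1 t2
    have t := t1.add t2 (hne _)
    rw [hi] at t
    have h := eq_touching_mul_exp hu (add_comm _ _) (hD.tangent _)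
      (by rw [hrad, p2]; simp [radiusOf]) t
    rw [show dir 10 = _ by rw [dir], show ((10 : ℤ) : ℝ) * (Real.pi / 12) =
      5 * Real.pi / 12 + 5 * Real.pi / 12 by push_cast; ring, ← h]
    exact hD.mem _
  · right
    rw [hi1, p1] at t1
    rw [p1, p2] at t2
    rw [p2, p3] at t3
    simp only [radiusOf, e1, e2, e3, if_true, Bool.false_eq_true, if_false] at t1 t2 t3
    have t := (t1.add t2 (hne _)).add t3 (hne _)
    rw [hi] at t
    have h := eq_touching_mul_exp hu (add_comm _ _) (hD.tangent _)
      (by rw [hrad, p3]; simp [radiusOf]) t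
    rw [show dir (-10) = dir 14 by
      rw [show (14 : ℤ) = 2 + 12 by norm_num, show (-10 : ℤ) = 2 - 12 by norm_num, dir_add_twelve,
        dir_sub_twelve]]
    rw [show dir 14 = _ by rw [dir], show ((14 : ℤ) : ℝ) * (Real.pi / 12) =
      5 * Real.pi / 12 + Real.pi / 3 + 5 * Real.pi / 12 by push_cast; ring, ← h]
    exact hD.mem _

/-- `IsEdge P c w` says that `P` contains the large discs about the ends of the edge from `c` in
the direction `w`, and the small disc to the left of this edge that touches both. -/
structure IsEdge (P : Set Disc) (c w : ℂ) : Prop where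
  norm_eq : ‖w‖ = 1
  large : ⟨c, 1⟩ ∈ P
  large' : ⟨c + edgeLength * w, 1⟩ ∈ P
  small : touching c (w * dir 1) c6 ∈ P

theorem norm_mul_dir {u : ℂ} (hu : ‖u‖ = 1) (m : ℤ) : ‖u * dir m‖ = 1 := by
  rw [norm_mul, hu, norm_dir, mul_one]

theorem IsCompactPacking.rotate_small_nat {P : Set Disc} (hP : IsCompactPacking c6 P) {c u : ℂ}
    (hu : ‖u‖ = 1) (hc : ⟨c, 1⟩ ∈ P) (hs : touching c u c6 ∈ P) (k : ℕ) :
    touching c (u * dir (2 * k)) c6 ∈ P := by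
  induction k with
  | zero => simpa [dir_zero] using hs
  | succ k ih =>
    have := hP.rotate_small (norm_mul_dir hu _) hc ih
    rw [mul_assoc, ← dir_add] at this
    rw [Nat.cast_succ, mul_add]
    exact this

theorem IsEdge.small_odd {P : Set Disc} (hP : IsCompactPacking c6 P) {c w : ℂ}
    (h : IsEdge P c w) (k : ℕ) : touching c (w * dir (2 * k + 1)) c6 ∈ P := by
  have := hP.rotate_small_nat (norm_mul_dir h.norm_eq 1) h.large h.small k
  rw [mul_assoc, ← dir_add] at this
  rwa [add_comm]

/-- Reversing an edge: the small disc to the right of the edge is one of the twelve around its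
initial point. -/
theorem IsEdge.neg {P : Set Disc} (hP : IsCompactPacking c6 P) {c w : ℂ}
    (h : IsEdge P c w) : IsEdge P (c + edgeLength * w) (-w) where
  norm_eq := by rw [norm_neg, h.norm_eq]
  large := h.large'
  large' := by simpa using h.large
  small := by
    convert h.small_odd hP 11 using 1
    have h23 : dir 23 = dir (-1) := by
      rw [show (23 : ℤ) = -1 + 12 + 12 by norm_num, dir_add_twelve, dir_add_twelve, neg_neg]
    have := edgeLength_eq
    simp only [touching]
    norm_num
    rw [h23]
    linear_combination w * this

/-- An edge yields the one turned by `60°` about its end: the small disc on the left of the new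
edge touches a second large disc, for which there are two places, one of them already covered. -/
theorem IsEdge.rotate {P : Set Disc} (hP : IsCompactPacking c6 P) {c w : ℂ}
    (h : IsEdge P c w) : IsEdge P c (w * dir 4) := by
  have hw := h.norm_eq
  have hr := c6_bounds
  have h5 : touching c (w * dir 5) c6 ∈ P := h.small_odd hP 2
  have h3 : touching c (w * dir 3) c6 ∈ P := h.small_odd hP 1
  have hlarge : touching (touching c (w * dir 3) c6).center (-(w * dir 3)) 1 ∈ P := by
    simpa [touching] using h.large
  refine ⟨norm_mul_dir hw 4, h.large, ?_, by rwa [mul_assoc, ← dir_add]⟩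
  obtain h1 | h1 := hP.rotate_large (by rw [norm_neg, norm_mul_dir hw]) h3 hlarge
  · exfalso
    -- This large disc would be centred at distance `1 + c₆ < 2` from the other end of the edge.
    have hc : (touching (touching c (w * dir 3) c6).center (-(w * dir 3) * dir 10) 1)
        = touching (c + edgeLength * w) (w * (dir 3 - dir (-1))) 1 := by
      have h13 : dir 13 = -dir 1 := dir_add_twelve 1
      have h10 := dir_add 3 10
      have := edgeLength_eq
      norm_num at h10
      simp only [touching]
      congr 1
      push_cast
      linear_combination -w * this + (1 + c6) * w * h10 - (1 + c6) * w * h13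
    replace h1 := hc ▸ h1
    have hn : ‖w * (dir 3 - dir (-1))‖ = 1 := by
      have h3 := dir_add (-1) 4
      have h7 := dir_add (-1) 8
      norm_num at h3 h7
      have : dir 3 - dir (-1) = dir 7 := by
        rw [h7, h3, dir_eight]
        ring
      rw [this, norm_mul_dir hw]
    have hne : (⟨c + edgeLength * w, 1⟩ : Disc)
        ≠ touching (c + edgeLength * w) (w * (dir 3 - dir (-1))) 1 := by
      intro heq
      have := congrArg Disc.center heq
      simp only [touching, left_eq_add, mul_eq_zero] at this
      rcases this with h0 | h0
      · norm_cast at h0; linarith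
      · rw [mul_eq_zero.2 h0] at hn; simp at hn
    have hd := hP.toIsPacking.radius_add_le_dist h.large' h1 hne
    simp only [touching, dist_self_add_right, norm_mul _ (w * _), hn, Complex.norm_real] at hd
    rw [Real.norm_of_nonneg (by linarith)] at hd
    linarith
  · convert h1 using 1
    have h7 : dir (-7) = -dir 5 := dir_sub_twelve 5
    have h10 := dir_add 3 (-10)
    have h4 := dir_add 4 1
    have h4' := dir_add 4 (-1)
    have := edgeLength_eq
    norm_num at h10 h4 h4'
    simp only [touching]
    congr 1
    push_cast
    linear_combination (w * dir 4) * this - (1 + c6) * w * (h4 + h4')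
      - (1 + c6) * w * h10 + (1 + c6) * w * h7

/-- A compact packing contains an edge. -/
theorem IsCompactPacking.exists_isEdge {P : Set Disc} (hP : IsCompactPacking c6 P) :
    ∃ c w, IsEdge P c w := by
  have hpack := hP.toIsPacking
  have hr := c6_pos
  have hr' : (1 + c6 : ℂ) ≠ 0 := by norm_cast; linarith
  obtain ⟨⟨c, ρ⟩, hd, hd1⟩ := hP.exists_large
  obtain rfl : ρ = 1 := hd1
  obtain ⟨n, D, hD⟩ := hP.surrounded _ hd
  have hs := hD.mem ⟨0, hD.length_pos⟩
  have ht := hD.tangent ⟨0, hD.length_pos⟩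
  generalize D ⟨0, hD.length_pos⟩ = s at hs ht
  have hsr := hP.radius_eq_c6_of_tangent hd hs ht rfl
  obtain ⟨u, hu⟩ : ∃ u, s.center - c = ((1 + c6 : ℝ) : ℂ) * u :=
    ⟨(s.center - c) / ((1 + c6 : ℝ) : ℂ), by push_cast; field_simp⟩
  have hs' : s = touching c u c6 := by
    obtain ⟨s, ρ⟩ := s
    simp only [touching, Disc.mk.injEq]
    exact ⟨by linear_combination hu, hsr⟩
  have hu1 : ‖u‖ = 1 := by
    have := ht.norm_sub
    rw [hsr, hu, norm_mul, Complex.norm_real, Real.norm_of_nonneg (by linarith)] at this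
    apply mul_left_cancel₀ (by linarith : 1 + c6 ≠ 0)
    linarith
  rw [hs'] at hs
  have hlarge : touching (touching c u c6).center (-u) 1 ∈ P := by
    simpa [touching] using hd
  have he := edgeLength_eq
  rcases hP.rotate_large (by rw [norm_neg, hu1]) hs hlarge with h | h
  · refine ⟨c, u * dir (-1), norm_mul_dir hu1 _, hd, ?_, ?_⟩
    · convert h using 1
      have h1 := dir_add (-1) (-1)
      have h2 := dir_add 1 (-1)
      have h3 := dir_sub_twelve 10
      norm_num [dir_zero] at h1 h2 h3
      simp only [touching]
      congr 1
      push_cast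
      linear_combination u * dir (-1) * he - (1 + c6) * u * (h1 + h2 - h3)
    · rwa [mul_assoc, ← dir_add, neg_add_cancel, dir_zero, mul_one]
  · refine ⟨c, u * dir 1, norm_mul_dir hu1 _, hd, ?_, ?_⟩
    · convert h using 1
      have h1 := dir_add 1 1
      have h2 := dir_add 1 (-1)
      have h3 := dir_add_twelve (-10)
      norm_num [dir_zero] at h1 h2 h3
      simp only [touching]
      congr 1
      push_cast
      linear_combination u * dir 1 * he - (1 + c6) * u * (h1 + h2 - h3)
    · rw [mul_assoc, ← dir_add]
      exact hP.rotate_small hu1 hd hs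

theorem IsEdge.rotate_three {P : Set Disc} (hP : IsCompactPacking c6 P) {c w : ℂ}
    (h : IsEdge P c w) : IsEdge P c (-w) := by
  have := ((h.rotate hP).rotate hP).rotate hP
  rw [mul_assoc, mul_assoc, ← dir_add, ← dir_add] at this
  norm_num [dir_twelve] at this
  exact this

/-- Reversing an edge and turning the reversed one by `180°` moves the edge along itself. -/
theorem IsEdge.translate {P : Set Disc} (hP : IsCompactPacking c6 P) {c w : ℂ}
    (h : IsEdge P c w) : IsEdge P (c + edgeLength * w) w := by
  simpa using (h.neg hP).rotate_three hP

theorem IsEdge.translate_int {P : Set Disc} (hP : IsCompactPacking c6 P) {c w : ℂ}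
    (h : IsEdge P c w) (a : ℤ) : IsEdge P (c + edgeLength * w * a) w := by
  induction a using Int.induction_on with
  | zero => simpa using h
  | succ a ih =>
    convert ih.translate hP using 1
    push_cast
    ring
  | pred a ih =>
    have := ((ih.rotate_three hP).translate hP).rotate_three hP
    rw [neg_neg] at this
    convert this using 1
    push_cast
    ring

theorem latticePoint_eq (a b : ℤ) : latticePoint a b = edgeLength * (a + b * dir 4) := by
  have h : ((4 : ℤ) : ℝ) * (Real.pi / 12) = Real.pi / 3 := by push_cast; ring
  rw [latticePoint, dir, h, edgeLength]

theorem IsEdge.translate_latticePoint {P : Set Disc} (hP : IsCompactPacking c6 P) {c w : ℂ}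
    (h : IsEdge P c w) (a b : ℤ) : IsEdge P (c + w * latticePoint a b) w := by
  have h1 := (((h.translate_int hP a).rotate hP).translate_int hP b)
  have h2 := ((h1.rotate hP).rotate hP).rotate_three hP
  have h3 : dir 4 * dir 4 * dir 4 = -1 := by
    rw [← dir_add, ← dir_add]
    norm_num [dir_twelve]
  convert h2 using 1
  · rw [latticePoint_eq]
    ring
  · linear_combination w * h3

/-- The isometry `z ↦ c + w z`, for a unit vector `w`. -/
noncomputable def motion (c : ℂ) (w : Circle) : ℂ ≃ᵢ ℂ :=
  (rotation w).toIsometryEquiv.trans (IsometryEquiv.addLeft c)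

theorem motion_apply (c : ℂ) (w : Circle) (z : ℂ) : motion c w z = c + w * z := rfl

theorem exp_eq_dir (k : ℕ) :
    Complex.exp (((Real.pi / 12 + k * (Real.pi / 6) : ℝ) : ℂ) * Complex.I) = dir (2 * k + 1) := by
  rw [dir]
  congr 3
  push_cast
  ring

theorem mem_hexagonalPacking_large (a b : ℤ) : ⟨latticePoint a b, 1⟩ ∈ hexagonalPacking :=
  Or.inl ⟨a, b, rfl⟩

/-- The description of the small discs of the hexagonal packing by means of `touching`. -/
theorem mem_hexagonalPacking_iff {d : Disc} : d ∈ hexagonalPacking ↔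
    (∃ a b : ℤ, d = ⟨latticePoint a b, 1⟩) ∨
    ∃ (a b : ℤ) (k : Fin 12), d = touching (latticePoint a b) (dir (2 * (k : ℕ) + 1)) c6 := by
  simp only [hexagonalPacking, exp_eq_dir, touching]
  rfl

/-- Every compact packing contains a copy of the hexagonal packing. -/
theorem IsCompactPacking.exists_image_subset {P : Set Disc} (hP : IsCompactPacking c6 P) :
    ∃ c w, Disc.map (motion c w) '' hexagonalPacking ⊆ P := by
  obtain ⟨c, w, h⟩ := hP.exists_isEdge
  refine ⟨c, ⟨w, mem_sphere_zero_iff_norm.2 h.norm_eq⟩, ?_⟩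
  rintro _ ⟨d, hd, rfl⟩
  rw [mem_hexagonalPacking_iff] at hd
  rcases hd with ⟨a, b, rfl⟩ | ⟨a, b, k, rfl⟩
  · exact (h.translate_latticePoint hP a b).large
  · convert (h.translate_latticePoint hP a b).small_odd hP k using 1
    simp only [Disc.map, touching]
    congr 1
    change c + w * _ = _
    ring

/-! ### Distances in the hexagonal packing -/

/-- The point with coordinates `x`, `y` in the basis of the triangular lattice. -/
noncomputable def latticeCoord (x y : ℝ) : ℂ := edgeLength * (x + y * dir 4)

theorem norm_latticeCoord_sq (x y : ℝ) :
    ‖latticeCoord x y‖ ^ 2 = (1 + c6) ^ 2 * (2 + √3) * (x ^ 2 + x * y + y ^ 2) := by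
  have h : √3 * √3 = 3 := Real.mul_self_sqrt (by norm_num)
  have h1 : ‖(x : ℂ) + y * dir 4‖ ^ 2 = x ^ 2 + x * y + y ^ 2 := by
    rw [← Complex.normSq_eq_norm_sq, Complex.normSq_apply, dir_four]
    simp
    linear_combination y ^ 2 / 4 * h
  have h2 : edgeLength ^ 2 = (1 + c6) ^ 2 * (2 + √3) := by
    rw [edgeLength, mul_pow, mul_pow, Real.cos_sq', sin_pi_div_twelve_sq]
    ring
  rw [latticeCoord, norm_mul, mul_pow, h1, Complex.norm_real, Real.norm_eq_abs, sq_abs, h2]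

theorem latticeCoord_sub (x y x' y' : ℝ) :
    latticeCoord x y - latticeCoord x' y' = latticeCoord (x - x') (y - y') := by
  simp only [latticeCoord]
  push_cast
  ring

/-- The parameter `p` such that `1 / 2 - p`, `2 p` are the lattice coordinates of the centre of a
small disc. -/
noncomputable def smallCoord : ℝ := √3 / 3 - 1 / 2

theorem smallCoord_eq : √3 = 3 * smallCoord + 3 / 2 := by rw [smallCoord]; ring

theorem smallCoord_sq : 12 * smallCoord ^ 2 = 1 - 12 * smallCoord := by
  have h : √3 * √3 = 3 := Real.mul_self_sqrt (by norm_num)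
  rw [smallCoord_eq] at h
  linarith

theorem smallCoord_bounds : 0.077 < smallCoord ∧ smallCoord < 0.0774 := by
  have := sqrt_three_bounds
  rw [smallCoord]
  constructor <;> linarith

theorem touching_dir_one (c : ℂ) :
    touching c (dir 1) c6 =
      ⟨c + latticeCoord (1 / 2 - smallCoord) (2 * smallCoord), c6⟩ := by
  have h1 : Real.sin (Real.pi / 12) = (2 - √3) * Real.cos (Real.pi / 12) := by
    have h1 := Real.sin_two_mul (Real.pi / 12)
    rw [show 2 * (Real.pi / 12) = Real.pi / 6 by ring, Real.sin_pi_div_six] at h1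
    have hs := sin_pi_div_twelve_pos
    apply mul_left_cancel₀ hs.ne'
    linear_combination sin_pi_div_twelve_sq + (2 - √3) / 2 * h1
  have h2 : √3 * √3 = 3 := Real.mul_self_sqrt (by norm_num)
  rw [touching, latticeCoord, dir_four, smallCoord]
  congr 2
  apply Complex.ext
  · simp [dir_re, dir_im, edgeLength, -Complex.ofReal_cos, -Complex.ofReal_sin]
    ring
  · simp [dir_re, dir_im, edgeLength, -Complex.ofReal_cos, -Complex.ofReal_sin]
    rw [h1]
    linear_combination -2 * (1 + c6) * Real.cos (Real.pi / 12) / 3 * h2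

/-- The lattice coordinates of the centres of the small discs. If `z = -x - y` is added as a third
coordinate, then modulo `1` two of the three coordinates are `1 / 2 - e` and the other one is
`2 e`, where `e` is `smallCoord` up to sign. -/
def IsSmallCoord (x y : ℝ) : Prop :=
  ∃ (m n : ℤ) (e : ℝ), (e = smallCoord ∨ e = -smallCoord) ∧
    ((x = m + 1 / 2 - e ∧ y = n + 2 * e) ∨ (x = m + 2 * e ∧ y = n + 1 / 2 - e) ∨
      (x = m + 1 / 2 - e ∧ y = n + 1 / 2 - e))

/-- The set of centres of small discs is invariant under the rotation by `60°`. -/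
theorem IsSmallCoord.rotate {x y : ℝ} (h : IsSmallCoord x y) : IsSmallCoord (-y) (x + y) := by
  obtain ⟨m, n, e, he, ⟨rfl, rfl⟩ | ⟨rfl, rfl⟩ | ⟨rfl, rfl⟩⟩ := h
  · refine ⟨-n, m + n, -e, by rcases he with rfl | rfl <;> simp, Or.inr (Or.inl ?_)⟩
    constructor <;> push_cast <;> ring
  · refine ⟨-n - 1, m + n, -e, by rcases he with rfl | rfl <;> simp, Or.inr (Or.inr ?_)⟩
    constructor <;> push_cast <;> ring
  · refine ⟨-n - 1, m + n + 1, -e, by rcases he with rfl | rfl <;> simp, Or.inl ?_⟩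
    constructor <;> push_cast <;> ring

theorem IsSmallCoord.add_int {x y : ℝ} (h : IsSmallCoord x y) (a b : ℤ) :
    IsSmallCoord (a + x) (b + y) := by
  obtain ⟨m, n, e, he, h⟩ := h
  refine ⟨a + m, b + n, e, he, ?_⟩
  push_cast
  rcases h with ⟨rfl, rfl⟩ | ⟨rfl, rfl⟩ | ⟨rfl, rfl⟩
  · left; constructor <;> ring
  · right; left; constructor <;> ring
  · right; right; constructor <;> ring

theorem latticeCoord_mul_dir_four (x y : ℝ) :
    latticeCoord x y * dir 4 = latticeCoord (-y) (x + y) := by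
  have h : dir 4 * dir 4 = dir 4 - 1 := by rw [← dir_add, ← dir_eight]; rfl
  simp only [latticeCoord]
  push_cast
  linear_combination edgeLength * y * h

theorem exists_isSmallCoord_aux {m : ℤ}
    (h : ∃ x y, IsSmallCoord x y ∧ ((1 + c6 : ℝ) : ℂ) * dir m = latticeCoord x y) (k : ℕ) :
    ∃ x y, IsSmallCoord x y ∧ ((1 + c6 : ℝ) : ℂ) * dir (m + 4 * k) = latticeCoord x y := by
  induction k with
  | zero => simpa using h
  | succ k ih =>
    obtain ⟨x, y, hxy, h⟩ := ih
    refine ⟨-y, x + y, hxy.rotate, ?_⟩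
    rw [← latticeCoord_mul_dir_four, ← h, mul_assoc, ← dir_add]
    push_cast
    ring_nf

theorem exists_isSmallCoord (k : ℕ) : ∃ x y, IsSmallCoord x y ∧
    ((1 + c6 : ℝ) : ℂ) * dir (2 * k + 1) = latticeCoord x y := by
  have h1 : ((1 + c6 : ℝ) : ℂ) * dir 1 = latticeCoord (1 / 2 - smallCoord) (2 * smallCoord) := by
    have := congrArg Disc.center (touching_dir_one 0)
    simpa [touching] using this
  have h3 : ((1 + c6 : ℝ) : ℂ) * dir (-1) =
      latticeCoord (1 / 2 + smallCoord) (-(2 * smallCoord)) := by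
    have := edgeLength_eq
    simp only [latticeCoord] at *
    push_cast at *
    linear_combination -h1 - this
  obtain ⟨j, rfl | rfl⟩ := Nat.even_or_odd' k
  · have := exists_isSmallCoord_aux ⟨_, _,
      ⟨0, 0, smallCoord, Or.inl rfl, Or.inl ⟨by simp, by simp⟩⟩, h1⟩ j
    convert this using 6
    push_cast
    ring_nf
  · have := exists_isSmallCoord_aux ⟨_, _,
      ⟨0, 0, -smallCoord, Or.inr rfl, Or.inl ⟨by simp, by simp⟩⟩, h3⟩ (j + 1)
    convert this using 6
    push_cast
    ring_nf

theorem latticePoint_eq_latticeCoord (a b : ℤ) : latticePoint a b = latticeCoord a b := by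
  rw [latticePoint_eq, latticeCoord]
  push_cast
  rfl

theorem exists_coord_of_mem {d : Disc} (hd : d ∈ hexagonalPacking) :
    (∃ a b : ℤ, d = ⟨latticeCoord a b, 1⟩) ∨
      ∃ x y, IsSmallCoord x y ∧ d = ⟨latticeCoord x y, c6⟩ := by
  rw [mem_hexagonalPacking_iff] at hd
  rcases hd with ⟨a, b, rfl⟩ | ⟨a, b, k, rfl⟩
  · exact Or.inl ⟨a, b, by rw [latticePoint_eq_latticeCoord]⟩
  · obtain ⟨x, y, hxy, h⟩ := exists_isSmallCoord k
    refine Or.inr ⟨_, _, hxy.add_int a b, ?_⟩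
    rw [touching, h, latticePoint_eq_latticeCoord]
    simp only [latticeCoord]
    push_cast
    ring_nf

theorem one_le_quadratic {a b : ℤ} (h : ¬(a = 0 ∧ b = 0)) :
    (1 : ℝ) ≤ (a : ℝ) ^ 2 + a * b + b ^ 2 := by
  have h1 : 0 < a ^ 2 + a * b + b ^ 2 := by
    by_contra! hle
    have hb : b = 0 := by
      have : b ^ 2 ≤ 0 := by nlinarith [sq_nonneg (2 * a + b)]
      exact pow_eq_zero_iff (two_ne_zero) |>.1 (le_antisymm this (sq_nonneg b))
    subst hb
    have : a ^ 2 ≤ 0 := by linarith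
    exact h ⟨pow_eq_zero_iff (two_ne_zero) |>.1 (le_antisymm this (sq_nonneg a)), rfl⟩
  exact_mod_cast h1

theorem half_le_abs_int_add_half (m : ℤ) : (1 / 2 : ℝ) ≤ |(m : ℝ) + 1 / 2| := by
  rcases le_or_gt 0 m with h | h
  · have : (0 : ℝ) ≤ m := by exact_mod_cast h
    rw [abs_of_nonneg (by linarith)]; linarith
  · have : (m : ℝ) ≤ -1 := by exact_mod_cast (by omega : m ≤ -1)
    rw [abs_of_neg (by linarith)]; linarith

theorem sq_le_int_add_sq (m : ℤ) {δ : ℝ} (h : |δ| ≤ 1 / 2) : δ ^ 2 ≤ (m + δ) ^ 2 := by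
  rw [abs_le] at h
  rcases lt_trichotomy m 0 with hm | rfl | hm
  · have : (m : ℝ) ≤ -1 := by exact_mod_cast (by omega : m ≤ -1)
    nlinarith
  · simp
  · have : (1 : ℝ) ≤ m := by exact_mod_cast hm
    nlinarith

theorem le_quadratic_of_small_aux {e : ℝ} (he : e = smallCoord ∨ e = -smallCoord) (m n : ℤ) :
    2 - √3 ≤ ((m : ℝ) + 1 / 2 - e) ^ 2 + (m + 1 / 2 - e) * (n + 2 * e) + (n + 2 * e) ^ 2 := by
  have hb := smallCoord_bounds
  have hsq := smallCoord_sq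
  have he2 : e ^ 2 = smallCoord ^ 2 := by rcases he with rfl | rfl <;> ring
  have h1 : ((m : ℝ) + 1 / 2 - e) ^ 2 + (m + 1 / 2 - e) * (n + 2 * e) + (n + 2 * e) ^ 2
      = (m + (n + 1) / 2) ^ 2 + 3 / 4 * (n + 2 * e) ^ 2 := by ring
  rw [h1, smallCoord_eq]
  rcases eq_or_ne n 0 with rfl | hn
  · have h2 := sq_abs ((m : ℝ) + 1 / 2)
    have h3 := half_le_abs_int_add_half m
    push_cast
    nlinarith
  · have h2 : (0.84 : ℝ) ≤ |(n : ℝ) + 2 * e| := by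
      have h4 : (1 : ℝ) ≤ |(n : ℝ)| := by exact_mod_cast Int.one_le_abs hn
      have h5 : |(2 * e)| ≤ 0.16 := by
        rw [abs_le]; rcases he with rfl | rfl <;> constructor <;> linarith
      have h6 := abs_sub_abs_le_abs_sub (n : ℝ) (-(2 * e))
      rw [abs_neg, sub_neg_eq_add] at h6
      linarith
    have h3 := sq_abs ((n : ℝ) + 2 * e)
    nlinarith [sq_nonneg ((m : ℝ) + (n + 1) / 2)]

/-- The centre of a small disc is at distance at least `1 + c₆` from the origin; by translation,
small discs do not overlap large ones. -/
theorem IsSmallCoord.le_quadratic {x y : ℝ} (h : IsSmallCoord x y) :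
    2 - √3 ≤ x ^ 2 + x * y + y ^ 2 := by
  obtain ⟨m, n, e, he, ⟨rfl, rfl⟩ | ⟨rfl, rfl⟩ | ⟨rfl, rfl⟩⟩ := h
  · exact le_quadratic_of_small_aux he m n
  · linarith [le_quadratic_of_small_aux he n m]
  · have h := le_quadratic_of_small_aux he m (-(m + n + 1))
    push_cast at h
    linarith

/-- A coordinate `1 / 2 - e` and a coordinate `2 e'` differ modulo `1` by at least
`1 / 2 - 3 p = 2 - √3`, where `p` is `smallCoord`. -/
theorem le_sq_of_half {e e' : ℝ} (he : e = smallCoord ∨ e = -smallCoord)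
    (he' : e' = smallCoord ∨ e' = -smallCoord) (m : ℤ) :
    (2 - √3) ^ 2 ≤ (m + 1 / 2 - e - 2 * e') ^ 2 := by
  have hb := smallCoord_bounds
  have h1 : |e + 2 * e'| ≤ 3 * smallCoord := by
    rw [abs_le]; rcases he with rfl | rfl <;> rcases he' with rfl | rfl <;> constructor <;> linarith
  have h2 := half_le_abs_int_add_half m
  have h3 := abs_sub_abs_le_abs_sub ((m : ℝ) + 1 / 2) (e + 2 * e')
  rw [smallCoord_eq, ← sq_abs (m + 1 / 2 - e - 2 * e'),
    show (m : ℝ) + 1 / 2 - e - 2 * e' = m + 1 / 2 - (e + 2 * e') by ring]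
  apply pow_le_pow_left₀ (by linarith)
  linarith

/-- The difference of two points described by `IsSmallCoord` with the coordinate `2 e` in the same
place: it is a lattice vector if the signs agree, and else its three coordinates are
`∓2 p`, `±4 p`, `∓2 p` modulo `1`, where `p` is `smallCoord`. -/
theorem le_quadratic_of_same {e e' : ℝ} (he : e = smallCoord ∨ e = -smallCoord)
    (he' : e' = smallCoord ∨ e' = -smallCoord) (m n : ℤ) :
    (m - e + e' = 0 ∧ n + 2 * e - 2 * e' = 0) ∨
    (2 - √3) ^ 2 ≤ (m - e + e') ^ 2 + (m - e + e') * (n + 2 * e - 2 * e')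
      + (n + 2 * e - 2 * e') ^ 2 := by
  have hb := smallCoord_bounds
  rcases eq_or_ne e e' with rfl | hne
  · by_cases h : m = 0 ∧ n = 0
    · left; simp [h]
    · right
      have h1 := one_le_quadratic h
      have h2 := sqrt_three_bounds
      nlinarith
  · right
    have hee : e' = -e := by
      rcases he with rfl | rfl <;> rcases he' with rfl | rfl <;> simp_all
    have hs : ∀ t : ℝ, |t| ≤ 4 → |t * e| ≤ 1 / 2 := by
      intro t ht
      have h1 : |e| ≤ 1 / 8 := by
        rw [abs_le]; rcases he with rfl | rfl <;> constructor <;> linarith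
      rw [abs_mul]
      nlinarith [abs_nonneg t, abs_nonneg e]
    have h1 := sq_le_int_add_sq m (hs (-2) (by norm_num [abs_le]))
    have h2 := sq_le_int_add_sq n (hs 4 (by norm_num [abs_le]))
    have h3 := sq_le_int_add_sq (-(m + n)) (hs (-2) (by norm_num [abs_le]))
    have he2 : e ^ 2 = smallCoord ^ 2 := by rcases he with rfl | rfl <;> ring
    push_cast at h3
    rw [hee, smallCoord_eq]
    have h4 := smallCoord_sq
    nlinarith

/-- Different small discs do not overlap. -/
theorem IsSmallCoord.sub_le_quadratic {x y x' y' : ℝ} (h : IsSmallCoord x y)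
    (h' : IsSmallCoord x' y') : (x - x' = 0 ∧ y - y' = 0) ∨
      (2 - √3) ^ 2 ≤ (x - x') ^ 2 + (x - x') * (y - y') + (y - y') ^ 2 := by
  obtain ⟨m, n, e, he, h⟩ := h
  obtain ⟨m', n', e', he', h'⟩ := h'
  have A := fun k : ℤ => le_sq_of_half he he' k
  have B := fun k : ℤ => le_sq_of_half he' he k
  have C := le_quadratic_of_same he he'
  -- If `u`, `v`, `w` add up to `0`, then `u² + u v + v² = (u² + v² + w²) / 2`.
  rcases h with ⟨rfl, rfl⟩ | ⟨rfl, rfl⟩ | ⟨rfl, rfl⟩ <;>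
    rcases h' with ⟨rfl, rfl⟩ | ⟨rfl, rfl⟩ | ⟨rfl, rfl⟩
  · refine (C (m - m') (n - n')).imp (fun h => ⟨?_, ?_⟩) fun h => ?_ <;> push_cast at h <;>
      linarith
  · right
    have a := A (m - m'); have b := B (n' - n)
    push_cast at a b
    linarith [sq_nonneg (m - e - m' - 2 * e' + (n + 2 * e - n' + e'))]
  · right
    have a := A (m' + n' - m - n); have b := B (n' - n)
    push_cast at a b
    linarith [sq_nonneg (m - e - m' + e')]
  · right
    have a := A (n - n'); have b := B (m' - m)
    push_cast at a b
    linarith [sq_nonneg (m + 2 * e - m' + e' + (n - e - n' - 2 * e'))]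
  · refine (C (n - n') (m - m')).imp (fun h => ⟨?_, ?_⟩) fun h => ?_ <;> push_cast at h <;>
      linarith
  · right
    have a := A (m' + n' - m - n); have b := B (m' - m)
    push_cast at a b
    linarith [sq_nonneg (n - e - n' + e')]
  · right
    have a := A (n - n'); have b := B (m + n - m' - n')
    push_cast at a b
    linarith [sq_nonneg (m - e - m' + e')]
  · right
    have a := A (m - m'); have b := B (m + n - m' - n')
    push_cast at a b
    linarith [sq_nonneg (n - e - n' + e')]
  · refine (C (m - m') (m' + n' - m - n)).imp (fun h => ⟨?_, ?_⟩) fun h => ?_ <;>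
      push_cast at h <;> linarith

/-- Different discs of the hexagonal packing do not overlap. -/
theorem radius_add_le_dist_of_mem {d d' : Disc} (hd : d ∈ hexagonalPacking)
    (hd' : d' ∈ hexagonalPacking) (hne : d ≠ d') :
    d.radius + d'.radius ≤ dist d.center d'.center := by
  have hr := c6_bounds
  have h3 := sqrt_three_bounds
  have hsq : √3 * √3 = 3 := Real.mul_self_sqrt (by norm_num)
  have h0 : 0 < (1 + c6) ^ 2 * (2 + √3) := by
    have := c6_pos
    positivity
  -- The factor `(1 + c₆)² (2 + √3)` is the squared length of the edges.
  have large_small : ∀ (a b : ℤ) (x y : ℝ), IsSmallCoord x y →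
      c6 + 1 ≤ dist (latticeCoord x y) (latticeCoord a b) := by
    intro a b x y h
    rw [dist_eq_norm, latticeCoord_sub]
    apply le_of_sq_le_sq _ (norm_nonneg _)
    have h1 := (h.add_int (-a) (-b)).le_quadratic
    push_cast at h1
    rw [neg_add_eq_sub, neg_add_eq_sub] at h1
    rw [norm_latticeCoord_sq]
    calc (c6 + 1) ^ 2 = (1 + c6) ^ 2 * (2 + √3) * (2 - √3) := by
          linear_combination (1 + c6) ^ 2 * hsq
      _ ≤ _ := mul_le_mul_of_nonneg_left h1 h0.le
  rcases exists_coord_of_mem hd with ⟨a, b, rfl⟩ | ⟨x, y, h, rfl⟩ <;>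
    rcases exists_coord_of_mem hd' with ⟨a', b', rfl⟩ | ⟨x', y', h', rfl⟩
  · have hab : ¬(a - a' = 0 ∧ b - b' = 0) := by
      rintro ⟨h1, h2⟩
      rw [sub_eq_zero] at h1 h2
      exact hne (by rw [h1, h2])
    have h1 := one_le_quadratic hab
    push_cast at h1
    rw [dist_eq_norm, latticeCoord_sub]
    apply le_of_sq_le_sq _ (norm_nonneg _)
    rw [norm_latticeCoord_sq]
    calc ((1 : ℝ) + 1) ^ 2 ≤ (1 + c6) ^ 2 * (2 + √3) * 1 := by nlinarith
      _ ≤ _ := mul_le_mul_of_nonneg_left h1 h0.le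
  · rw [dist_comm, add_comm]
    exact large_small a b x' y' h'
  · exact large_small a' b' x y h
  · rcases h.sub_le_quadratic h' with ⟨h1, h2⟩ | h1
    · rw [sub_eq_zero] at h1 h2
      exact absurd (by rw [h1, h2]) hne
    · rw [dist_eq_norm, latticeCoord_sub]
      apply le_of_sq_le_sq _ (norm_nonneg _)
      rw [norm_latticeCoord_sq]
      calc (c6 + c6) ^ 2 = (1 + c6) ^ 2 * (2 + √3) * (2 - √3) ^ 2 := by
            linear_combination 4 * (c6 + (1 + c6) * Real.sin (Real.pi / 12)) * c6_eq
              + 4 * (1 + c6) ^ 2 * sin_pi_div_twelve_sq + (1 + c6) ^ 2 * (2 - √3) * hsq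
        _ ≤ _ := mul_le_mul_of_nonneg_left h1 h0.le

theorem isPacking_hexagonalPacking : IsPacking c6 hexagonalPacking where
  radius_eq := by
    rintro d (⟨a, b, rfl⟩ | ⟨a, b, k, rfl⟩)
    · exact Or.inl rfl
    · exact Or.inr rfl
  disjoint := fun d hd e he hne => Metric.ball_disjoint_ball (radius_add_le_dist_of_mem hd he hne)
  exists_large := ⟨_, Or.inl ⟨0, 0, rfl⟩, rfl⟩
  exists_small := ⟨_, Or.inr ⟨0, 0, 0, rfl⟩, rfl⟩

/-! ### Neighbour sequences in the hexagonal packing -/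

theorem dir_eq_of_emod {m k : ℤ} (h : (m - k) % 24 = 0) : dir m = dir k := by
  obtain ⟨j, hj⟩ := Int.dvd_of_emod_eq_zero h
  have h24 : dir 24 = 1 := by
    rw [show (24 : ℤ) = 12 + 12 by norm_num, dir_add, dir_twelve]
    norm_num
  have hpow : ∀ j : ℤ, dir (24 * j) = 1 := by
    intro j
    induction j using Int.induction_on with
    | zero => exact dir_zero
    | succ j ih => rw [mul_add, dir_add, ih, mul_one, h24, mul_one]
    | pred j ih =>
      have := dir_add (24 * (-j - 1)) 24
      rw [h24, mul_one] at this
      rw [← this, ← ih]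
      ring_nf
  rw [show m = 24 * j + k by omega, dir_add, hpow, one_mul]

/-- The disc of radius `ρ` that touches the disc of radius `σ` about `c` in the direction
`dir m`. -/
noncomputable def polarDisc (c : ℂ) (σ : ℝ) (m : ℤ) (ρ : ℝ) : Disc :=
  ⟨c + ((σ + ρ : ℝ) : ℂ) * dir m, ρ⟩

theorem norm_polarDisc_sub {c : ℂ} {σ ρ : ℝ} (h : 0 < σ + ρ) (m : ℤ) :
    ‖(polarDisc c σ m ρ).center - c‖ = σ + ρ := by
  rw [polarDisc, add_sub_cancel_left, norm_mul, norm_dir, Complex.norm_real,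
    Real.norm_of_nonneg h.le, mul_one]

theorem tangent_polarDisc {c : ℂ} {σ ρ : ℝ} (h : 0 < σ + ρ) (m : ℤ) :
    (⟨c, σ⟩ : Disc).Tangent (polarDisc c σ m ρ) := by
  rw [Disc.Tangent, dist_comm, dist_eq_norm, norm_polarDisc_sub h]
  rfl

theorem turn_polarDisc {c : ℂ} {σ ρ ρ' : ℝ} (h : 0 < σ + ρ) (h' : 0 < σ + ρ') (m t : ℤ) :
    Turn ((polarDisc c σ m ρ).center - c) ((polarDisc c σ (m + t) ρ').center - c)
      (t * (Real.pi / 12)) := by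
  rw [Turn, norm_polarDisc_sub h, norm_polarDisc_sub h', ← dir]
  simp only [polarDisc, dir_add]
  ring

theorem tangent_polarDisc_polarDisc {c : ℂ} {σ ρ ρ' : ℝ} (hσ : 0 < σ) (hρ : 0 < ρ) (hρ' : 0 < ρ')
    {m t : ℤ} (ht : tangentAngle σ ρ ρ' = t * (Real.pi / 12)) :
    (polarDisc c σ m ρ).Tangent (polarDisc c σ (m + t) ρ') := by
  have h := (turn_polarDisc (c := c) (add_pos hσ hρ) (add_pos hσ hρ') m t).norm_sub_sq
    (by rw [← norm_pos_iff, norm_polarDisc_sub (by positivity)]; positivity)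
  have hcos : (σ + ρ) * (σ + ρ') * Real.cos (tangentAngle σ ρ ρ')
      = σ ^ 2 + σ * ρ + σ * ρ' - ρ * ρ' := by
    rw [tangentAngle, Real.cos_arccos, mul_div_cancel₀ _ (by positivity)]
    · rw [le_div_iff₀ (by positivity)]
      nlinarith [mul_pos hσ hρ, mul_pos hσ hρ', mul_pos hσ hσ]
    · rw [div_le_one (by positivity)]
      nlinarith [mul_pos hρ hρ']
  rw [ht] at hcos
  rw [norm_polarDisc_sub (by positivity), norm_polarDisc_sub (by positivity),
    sub_sub_sub_cancel_right] at h
  rw [Disc.Tangent, dist_comm, dist_eq_norm]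
  change _ = ρ + ρ'
  rw [← sq_eq_sq₀ (norm_nonneg _) (by positivity), h]
  linear_combination -2 * hcos

theorem angle_polarDisc {c : ℂ} {σ ρ ρ' : ℝ} (h : 0 < σ + ρ) (h' : 0 < σ + ρ') (m : ℤ) {t : ℤ}
    (h0 : 0 < t) (ht : t ≤ 12) :
    (⟨c, σ⟩ : Disc).angle (polarDisc c σ m ρ) (polarDisc c σ (m + t) ρ') = t * (Real.pi / 12) := by
  have hne : (polarDisc c σ m ρ).center - c ≠ 0 := by
    rw [← norm_pos_iff, norm_polarDisc_sub h]; exact h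
  have hne' : (polarDisc c σ (m + t) ρ').center - c ≠ 0 := by
    rw [← norm_pos_iff, norm_polarDisc_sub h']; exact h'
  have h1 : (0 : ℝ) < t := by exact_mod_cast h0
  have h2 : (t : ℝ) ≤ 12 := by exact_mod_cast ht
  have hpi := Real.pi_pos
  refine (turn_arg hne _).unique (turn_polarDisc h h' m t) hne hne' ?_
  have h3 := Complex.neg_pi_lt_arg
    (((polarDisc c σ (m + t) ρ').center - c) / ((polarDisc c σ m ρ).center - c))
  have h4 := Complex.arg_le_pi
    (((polarDisc c σ (m + t) ρ').center - c) / ((polarDisc c σ m ρ).center - c))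
  rw [abs_lt]
  constructor <;> nlinarith

/-- Discs around a given one in directions that are multiples of `15°` form a neighbour sequence
as soon as the angles are those between tangent discs and add up to `24` times `15°`. -/
theorem isNeighbourSequence_polarDisc {P : Set Disc} {c : ℂ} {σ : ℝ} (hσ : 0 < σ) {n : ℕ}
    (m t : Fin n → ℤ) (ρ : Fin n → ℝ) (hρ : ∀ i, 0 < ρ i)
    (hmem : ∀ i, polarDisc c σ (m i) (ρ i) ∈ P)
    (hm : ∀ i, (m (finRotate n i) - (m i + t i)) % 24 = 0) (h0 : ∀ i, 0 < t i)
    (h12 : ∀ i, t i ≤ 12)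
    (ht : ∀ i, tangentAngle σ (ρ i) (ρ (finRotate n i)) = t i * (Real.pi / 12))
    (hsum : ∑ i, t i = 24) :
    IsNeighbourSequence P ⟨c, σ⟩ fun i => polarDisc c σ (m i) (ρ i) := by
  have heq : ∀ i, polarDisc c σ (m (finRotate n i)) (ρ (finRotate n i))
      = polarDisc c σ (m i + t i) (ρ (finRotate n i)) := fun i => by
    rw [polarDisc, dir_eq_of_emod (hm i)]; rfl
  have hangle : ∀ i, (⟨c, σ⟩ : Disc).angle (polarDisc c σ (m i) (ρ i))
      (polarDisc c σ (m (finRotate n i)) (ρ (finRotate n i))) = t i * (Real.pi / 12) := fun i => by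
    rw [heq, angle_polarDisc (add_pos hσ (hρ _)) (add_pos hσ (hρ _)) _ (h0 i) (h12 i)]
  refine ⟨hmem, fun i => tangent_polarDisc (add_pos hσ (hρ i)) _, fun i => ?_, fun i => ?_, ?_⟩
  · rw [heq]
    exact tangent_polarDisc_polarDisc hσ (hρ _) (hρ _) (ht i)
  · have : (0 : ℝ) < t i := by exact_mod_cast h0 i
    rw [hangle]
    positivity
  · simp_rw [hangle]
    rw [← Finset.sum_mul, ← Int.cast_sum, hsum]
    push_cast
    ring

theorem mem_hexagonalPacking_small (a b : ℤ) {m : ℤ} (hm : m % 2 = 1) :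
    touching (latticePoint a b) (dir m) c6 ∈ hexagonalPacking := by
  rw [mem_hexagonalPacking_iff]
  refine Or.inr ⟨a, b, ⟨(((m - 1) / 2) % 12).toNat, by omega⟩, ?_⟩
  rw [dir_eq_of_emod]
  simp only
  omega

theorem exists_latticePoint_add (a b j : ℤ) :
    ∃ a' b' : ℤ, latticePoint a b + edgeLength * dir (4 * j) = latticePoint a' b' := by
  have h : ∃ x y : ℤ, dir (4 * j) = x + y * dir 4 := by
    have h8 : dir 4 * dir 4 = dir 4 - 1 := by rw [← dir_add, ← dir_eight]; rfl
    induction j using Int.induction_on with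
    | zero => exact ⟨1, 0, by simp [dir_zero]⟩
    | succ j ih =>
      obtain ⟨x, y, h⟩ := ih
      refine ⟨-y, x + y, ?_⟩
      rw [mul_add, dir_add, h, mul_one]
      push_cast
      linear_combination y * h8
    | pred j ih =>
      obtain ⟨x, y, h⟩ := ih
      have h4 : dir (-4) = 1 - dir 4 := by
        have := dir_sub_twelve 8
        rw [dir_eight] at this
        norm_num at this
        exact this
      refine ⟨x + y, -x, ?_⟩
      rw [show (4 : ℤ) * (-j - 1) = 4 * -j + -4 by ring, dir_add, h, h4]
      push_cast
      linear_combination -y * h8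
  obtain ⟨x, y, h⟩ := h
  refine ⟨a + x, b + y, ?_⟩
  rw [latticePoint_eq, latticePoint_eq, h]
  push_cast
  ring

theorem exists_neighbourSequence_large (a b : ℤ) : ∃ (n : ℕ) (D : Fin n → Disc),
    IsNeighbourSequence hexagonalPacking ⟨latticePoint a b, 1⟩ D := by
  refine ⟨12, _, isNeighbourSequence_polarDisc one_pos (fun i => 2 * (i : ℕ) + 1) (fun _ => 2)
    (fun _ => c6) (fun _ => c6_pos) (fun i => ?_) (by decide) (by decide) (by decide) (fun _ => ?_)
    (by decide)⟩
  · exact mem_hexagonalPacking_small a b (by omega)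
  · rw [tangentAngle_large_small_small]
    push_cast
    ring

/-- The neighbours of a small disc in a direction `15°` to the left of an edge of the lattice. -/
theorem exists_neighbourSequence_small (a b j : ℤ) : ∃ (n : ℕ) (D : Fin n → Disc),
    IsNeighbourSequence hexagonalPacking (touching (latticePoint a b) (dir (4 * j + 1)) c6) D := by
  obtain ⟨a', b', hL⟩ := exists_latticePoint_add a b j
  have hℓ := edgeLength_eq
  have h2r := two_mul_c6_eq
  have key : ∀ k : ℤ, dir (4 * j + k) = dir (4 * j) * dir k := fun k => dir_add _ _
  have t1 : tangentAngle c6 1 c6 = ((5 : ℤ) : ℝ) * (Real.pi / 12) := by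
    rw [tangentAngle_small_large_small]; push_cast; ring
  have t2 : tangentAngle c6 c6 1 = ((5 : ℤ) : ℝ) * (Real.pi / 12) := by
    rw [tangentAngle_comm, t1]
  have t3 : tangentAngle c6 c6 c6 = ((4 : ℤ) : ℝ) * (Real.pi / 12) := by
    rw [tangentAngle_self c6_pos]; push_cast; ring
  refine ⟨5, _, isNeighbourSequence_polarDisc c6_pos
    ![4 * j + 13, 4 * j + 18, 4 * j + 23, 4 * j + 28, 4 * j + 32] ![5, 5, 5, 4, 5]
    ![1, c6, 1, c6, c6] ?_ ?_ ?_ (by decide) (by decide) ?_ (by decide)⟩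
  · intro i; fin_cases i <;> simp [c6_pos]
  · have e13 : dir 13 = -dir 1 := dir_add_twelve 1
    have e23 : dir 23 = dir (-1) := dir_eq_of_emod (by norm_num)
    have e27 : dir 27 = dir 3 := dir_eq_of_emod (by norm_num)
    have e33 : dir 33 = dir 9 := dir_eq_of_emod (by norm_num)
    have e37 : dir 37 = dir 13 := dir_eq_of_emod (by norm_num)
    have p18 := dir_add 5 18
    have q18 := dir_add (-5) 18
    have p28 := dir_add 5 28
    have q28 := dir_add (-5) 28
    have p32 := dir_add 5 32
    have q32 := dir_add (-5) 32
    norm_num at p18 q18 p28 q28 p32 q32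
    intro i
    fin_cases i
    · change polarDisc _ c6 (4 * j + 13) 1 ∈ hexagonalPacking
      convert mem_hexagonalPacking_large a b using 1
      simp only [polarDisc, key]
      congr 1
      push_cast
      linear_combination (1 + c6) * dir (4 * j) * e13
    · change polarDisc _ c6 (4 * j + 18) c6 ∈ hexagonalPacking
      convert mem_hexagonalPacking_small a b (m := 4 * j + 23) (by omega) using 1
      simp only [polarDisc, touching, key]
      congr 1
      push_cast
      linear_combination dir (4 * j) * dir 18 * h2r
        - (1 + c6) * dir (4 * j) * (p18 + q18 - e13)
    · change polarDisc _ c6 (4 * j + 23) 1 ∈ hexagonalPacking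
      convert mem_hexagonalPacking_large a' b' using 1
      rw [← hL]
      simp only [polarDisc, key]
      congr 1
      push_cast
      linear_combination (1 + c6) * dir (4 * j) * e23 - dir (4 * j) * hℓ
    · change polarDisc _ c6 (4 * j + 28) c6 ∈ hexagonalPacking
      convert mem_hexagonalPacking_small a' b' (m := 4 * j + 9) (by omega) using 1
      rw [← hL]
      simp only [polarDisc, touching, key]
      congr 1
      push_cast
      linear_combination dir (4 * j) * dir 28 * h2r - dir (4 * j) * hℓ
        - (1 + c6) * dir (4 * j) * (p28 + q28 - e33 - e23)
    · change polarDisc _ c6 (4 * j + 32) c6 ∈ hexagonalPacking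
      convert mem_hexagonalPacking_small a b (m := 4 * j + 3) (by omega) using 1
      simp only [polarDisc, touching, key]
      congr 1
      push_cast
      linear_combination dir (4 * j) * dir 32 * h2r
        - (1 + c6) * dir (4 * j) * (p32 + q32 - e37 - e13 - e27)
  · intro i; fin_cases i <;> simp <;> omega
  · intro i; fin_cases i
    · exact t1
    · exact t2
    · exact t1
    · exact t3
    · exact t2

theorem isCompactPacking_hexagonalPacking : IsCompactPacking c6 hexagonalPacking where
  toIsPacking := isPacking_hexagonalPacking
  surrounded := by
    intro d hd
    rw [mem_hexagonalPacking_iff] at hd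
    rcases hd with ⟨a, b, rfl⟩ | ⟨a, b, k, rfl⟩
    · exact exists_neighbourSequence_large a b
    · obtain ⟨j, hj | hj⟩ := Nat.even_or_odd' (k : ℕ)
      · convert exists_neighbourSequence_small a b j using 7
        rw [hj]
        push_cast
        ring
      · -- The disc lies to the right of the edge from `(a, b)` in the direction `4 (j + 1)`, that
        -- is, to the left of the reversed edge.
        obtain ⟨a', b', hL⟩ := exists_latticePoint_add a b (j + 1)
        convert exists_neighbourSequence_small a' b' (j + 4) using 5
        have hℓ := edgeLength_eq
        have e1 : dir (2 * (2 * j + 1) + 1) = dir (4 * (j + 1)) * dir (-1) := by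
          rw [← dir_add]
          ring_nf
        have e2 : dir (4 * (j + 4) + 1) = -(dir (4 * (j + 1)) * dir 1) := by
          rw [← dir_add, ← dir_add_twelve]
          ring_nf
        rw [← hL, hj]
        simp only [touching]
        congr 1
        push_cast
        rw [e1, e2]
        linear_combination -dir (4 * (j + 1)) * hℓ

/-! ### Uniqueness -/

theorem IsNeighbourSequence.map {P : Set Disc} {d : Disc} {n : ℕ} {D : Fin n → Disc}
    (hD : IsNeighbourSequence P d D) (c : ℂ) (w : Circle) :
    IsNeighbourSequence (Disc.map (motion c w) '' P) (d.map (motion c w))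
      fun i => (D i).map (motion c w) := by
  have htan : ∀ {e f : Disc}, e.Tangent f →
      (e.map (motion c w)).Tangent (f.map (motion c w)) := fun h =>
    ((motion c w).isometry.dist_eq _ _).trans h
  have hangle : ∀ e f : Disc, (d.map (motion c w)).angle (e.map (motion c w))
      (f.map (motion c w)) = d.angle e f := fun e f => by
    simp only [Disc.angle, Disc.map, motion_apply, add_sub_add_left_eq_sub, ← mul_sub]
    rw [mul_div_mul_left _ _ w.coe_ne_zero]
  refine ⟨fun i => ⟨_, hD.mem i, rfl⟩, fun i => htan (hD.tangent i),
    fun i => htan (hD.tangent_succ i), fun i => ?_, ?_⟩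
  · rw [hangle]
    exact hD.angle_pos i
  · simp_rw [hangle]
    exact hD.angle_sum

theorem IsNeighbourSequence.mono {P Q : Set Disc} (h : P ⊆ Q) {d : Disc} {n : ℕ}
    {D : Fin n → Disc} (hD : IsNeighbourSequence P d D) : IsNeighbourSequence Q d D :=
  ⟨fun i => h (hD.mem i), hD.tangent, hD.tangent_succ, hD.angle_pos, hD.angle_sum⟩

/-- The copy of the hexagonal packing inside a compact packing is closed under tangency, since each
of its discs has a neighbour sequence within the copy; by connectedness it is the whole packing. -/
theorem IsCompactPacking.exists_eq_image {P : Set Disc} (hP : IsCompactPacking c6 P) :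
    ∃ g : ℂ ≃ᵢ ℂ, P = Disc.map g '' hexagonalPacking := by
  obtain ⟨c, w, hsub⟩ := hP.exists_image_subset
  refine ⟨motion c w, (hP.eq_of_tangent_mem hsub ?_ ?_).symm⟩
  · obtain ⟨d, hd, -⟩ := isPacking_hexagonalPacking.exists_large
    exact ⟨_, d, hd, rfl⟩
  · rintro _ ⟨d, hd, rfl⟩ e he hde
    obtain ⟨n, D, hD⟩ := isCompactPacking_hexagonalPacking.surrounded d hd
    have hD' := (hD.map c w).mono hsub
    obtain ⟨i, rfl⟩ := hD'.mem_range hP.toIsPacking (hsub ⟨d, hd, rfl⟩) he hde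
    exact ⟨_, hD.mem i, rfl⟩

theorem mainTheorem2 :
    IsCompactPacking c6 hexagonalPacking ∧
    ∀ P : Set Disc, IsCompactPacking c6 P →
      (∀ d ∈ P, ∀ (n : ℕ) (D : Fin n → Disc), IsNeighbourSequence P d D →
        Set.range D = {e | e ∈ P ∧ d.Tangent e} ∧ Function.Injective D ∧
        (d.radius = c6 →
          (List.ofFn fun i => (D i).radius).IsRotated [1, c6, c6, 1, c6]) ∧
        (d.radius = 1 →
          (List.ofFn fun i => (D i).radius) = List.replicate 12 c6)) ∧
      ∃ g : ℂ ≃ᵢ ℂ, P = Disc.map g '' hexagonalPacking := by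
  refine ⟨isCompactPacking_hexagonalPacking, fun P hP => ⟨fun d hd n D hD => ?_,
    hP.exists_eq_image⟩⟩
  exact ⟨hD.range_eq hP.toIsPacking hd, hD.injective hP.toIsPacking hd,
    hD.isRotated_of_small hP hd, hD.radii_of_large hP hd⟩
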